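/- Let $(A_0,A_1)$ be an ordered pair of Banach spaces: $A_1\subset A_0$ with $\|a\|_{A_0}\le\|a\|_{A_1}$ for $a\in A_1$, and let $A_1$ be dense in $A_0$. Let $(\Omega,\mu)$ be a finite measure space and let $\alpha>0$. For $x\in A_0$ and $t>0$ put $$K(t,x)=\inf\{\|x-a\|_{A_0}+t\|a\|_{A_1}:a\in A_1\},$$ and let $k(s,x)$ be the right derivative of the concave function $s\mapsto K(s,x)$, so that $K(t,x)=\int_0^t k(s,x)\,ds$ with $k(\cdot,x)$ decreasing. For $0<\theta<1$ let $p_\theta=1/(1-\theta)$ and let $(A_0,A_1)^{K\blacktriangleleft}_{\theta,p_\theta}$ be the space of those $x\in A_0$ for which the norm $$\|x\|=\bigl(p_\theta\,\theta(1-\theta)\bigr)^{1/p_\theta}\Bigl(\int_0^\infty\bigl(s^{-\theta}K(s,x)\bigr)^{p_\theta}\,\frac{ds}{s}\Bigr)^{1/p_\theta}$$ is finite. Let $\sum_{\theta}\theta^{-\alpha}L^{p_\theta}\bigl(\Omega,(A_0,A_1)^{K\blacktriangleleft}_{\theta,p_\theta}\bigr)$ be the space of all $f\in L^1(\Omega,A_0)$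 that can be written as $f=\sum_{0<\theta<1} f_\theta$, convergent in $L^1(\Omega,A_0)$, with $f_\theta\in L^{p_\theta}\bigl(\Omega,(A_0,A_1)^{K\blacktriangleleft}_{\theta,p_\theta}\bigr)$ (Bochner spaces) and $$\sum_{0<\theta<1}\theta^{-\alpha}\,\|f_\theta\|_{L^{p_\theta}(\Omega,(A_0,A_1)^{K\blacktriangleleft}_{\theta,p_\theta})}<\infty,$$ normed by the infimum of these sums over all such representations. For $f\in L^1(\Omega,A_0)=L^1(\Omega,A_0)+L^\infty(\Omega,A_1)$ put $\Psi_f(w,s)=k(s,f(w))$ for $(w,s)\in\Omega\times(0,1)$. Here $L(\mathrm{Log}L)^\alpha(\Omega\times(0,1))$, with respect to the product of $\mu$ and Lebesgue measure, consists of the measurable $g$ with $\int|g|\,(\log^+|g|)^\alpha<\infty$, and its norm is $\|g\|_{L(\mathrm{Log}L)^\alpha}=\inf\{c>0:\int\frac{|g|}{c}\bigl(\log(e+\frac{|g|}{c})\bigr)^\alpha\le1\}$. Then $$\sum_{\theta}\theta^{-\alpha}L^{p_\theta}\bigl(\Omega,(A_0,A_1)^{K\blacktriangleleft}_{\theta,p_\theta}\bigr)=\{f\in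 L^1(\Omega,A_0):\Psi_f\in L(\mathrm{Log}L)^\alpha(\Omega\times(0,1))\},$$ with equivalence of the norm of the space on the left and $\|\Psi_f\|_{L(\mathrm{Log}L)^\alpha(\Omega\times(0,1))}$. -/

import Mathlib

open MeasureTheory Set Filter Topology
open scoped ENNReal NNReal

noncomputable section

namespace VectorYano

section Pair

variable {𝕜 A₀ A₁ : Type*} [RCLike 𝕜]
  [NormedAddCommGroup A₀] [NormedSpace 𝕜 A₀] [NormedAddCommGroup A₁] [NormedSpace 𝕜 A₁]

/-- An ordered pair `(A₀, A₁)` is given by the inclusion `ι : A₁ → A₀`: an injective linear map of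
norm at most one. We also ask that `A₀ ∩ A₁ = A₁` be dense in `A₀`. -/
structure IsOrderedPair (ι : A₁ →L[𝕜] A₀) : Prop where
  injective : Function.Injective ι
  norm_le_one : ‖ι‖ ≤ 1
  dense : DenseRange ι

/-- Peetre's functional `K(t, x) = inf {‖a₀‖ + t ‖a₁‖ : x = a₀ + a₁}`, where `A₀ + A₁ = A₀`, so
that `a₀ = x - ι a₁` and the infimum is over `a₁ ∈ A₁`. -/
def kFunctional (ι : A₁ →L[𝕜] A₀) (t : ℝ) (x : A₀) : ℝ :=
  ⨅ a : A₁, (‖x - ι a‖ + t * ‖a‖)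

/-- The right derivative `k(s, x)` of the concave function `s ↦ K(s, x)`; it is the right-continuous
decreasing function with `K(t, x) = ∫₀ᵗ k(s, x) ds`. -/
def kDensity (ι : A₁ →L[𝕜] A₀) (s : ℝ) (x : A₀) : ℝ :=
  derivWithin (fun t => kFunctional ι t x) (Ioi s) s

/-- The normalized norm of `(A₀, A₁)_{θ,q}`, with value `∞` outside the space:
`(q θ (1 - θ))^{1/q} (∫₀^∞ (s^{-θ} K(s, x))^q ds / s)^{1/q}` (`0 < θ < 1`, `1 ≤ q < ∞`). -/
def interpNorm (ι : A₁ →L[𝕜] A₀) (θ q : ℝ) (x : A₀) : ℝ≥0∞ :=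
  ENNReal.ofReal ((q * θ * (1 - θ)) ^ (1 / q)) *
    (∫⁻ s in Ioi (0 : ℝ), ENNReal.ofReal ((s ^ (-θ) * kFunctional ι s x) ^ q / s)) ^ (1 / q)

variable {Ω : Type*} [MeasurableSpace Ω]

/-- `f` is `μ`-strongly measurable as a function with values in the normed space `(A₀, A₁)_{θ,q}`:
almost everywhere it is the limit, in the norm of that space, of a sequence of simple functions
with values in that space. -/
def StronglyMeasurableInto (ι : A₁ →L[𝕜] A₀) (θ q : ℝ) (μ : Measure Ω) (f : Ω → A₀) : Prop :=
  ∃ F : ℕ → SimpleFunc Ω A₀, (∀ n w, interpNorm ι θ q (F n w) < ∞) ∧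
    ∀ᵐ w ∂μ, Tendsto (fun n => interpNorm ι θ q (f w - F n w)) atTop (𝓝 0)

/-- The norm of `L^p(Ω, (A₀, A₁)_{θ,q})`, with the normalized norm on `(A₀, A₁)_{θ,q}`. -/
def vectorLpNorm (ι : A₁ →L[𝕜] A₀) (θ q p : ℝ) (μ : Measure Ω) (f : Ω → A₀) : ℝ≥0∞ :=
  (∫⁻ w, interpNorm ι θ q (f w) ^ p ∂μ) ^ (1 / p)

/-- Membership in the Bochner space `L^p(Ω, (A₀, A₁)_{θ,q})`. -/
def MemVectorLp (ι : A₁ →L[𝕜] A₀) (θ q p : ℝ) (μ : Measure Ω) (f : Ω → A₀) : Prop :=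
  StronglyMeasurableInto ι θ q μ f ∧ vectorLpNorm ι θ q p μ f < ∞

/-- The exponent `p_θ` with `1 / p_θ = 1 - θ`. -/
def pExp (θ : ℝ) : ℝ := 1 / (1 - θ)

/-- The representations `f = ∑_θ g_θ` in `L¹(Ω, A₀)` with `g_θ ∈ L^{p_θ}(Ω, (A₀, A₁)_{θ,p_θ})`. -/
def sumRepresentations (ι : A₁ →L[𝕜] A₀) (μ : Measure Ω) (f : Lp A₀ 1 μ) :
    Set (Ioo (0 : ℝ) 1 → Lp A₀ 1 μ) :=
  {g | (∀ θ : Ioo (0 : ℝ) 1, MemVectorLp ι θ (pExp θ) (pExp θ) μ (g θ)) ∧ HasSum g f}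

/-- The quotient norm of the extrapolation space `∑_θ θ^{-α} L^{p_θ}(Ω, (A₀, A₁)_{θ,p_θ})`, namely
the infimum of `∑_θ θ^{-α} ‖g_θ‖` over all representations of `f`; it is `∞` outside the space. -/
def sumNorm (ι : A₁ →L[𝕜] A₀) (α : ℝ) (μ : Measure Ω) (f : Lp A₀ 1 μ) : ℝ≥0∞ :=
  ⨅ g ∈ sumRepresentations ι μ f,
    ∑' θ : Ioo (0 : ℝ) 1,
      ENNReal.ofReal ((θ : ℝ) ^ (-α)) * vectorLpNorm ι θ (pExp θ) (pExp θ) μ (g θ)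

/-- The extrapolation space `∑_θ θ^{-α} L^{p_θ}(Ω, (A₀, A₁)_{θ,p_θ})`, inside `L¹(Ω, A₀)`. -/
def sumSpace (ι : A₁ →L[𝕜] A₀) (α : ℝ) (μ : Measure Ω) : Set (Lp A₀ 1 μ) :=
  {f | sumNorm ι α μ f < ∞}

/-- The function `Ψ_f(w, s) = k(s, f(w))`. -/
def Psi (ι : A₁ →L[𝕜] A₀) (f : Ω → A₀) (z : Ω × ℝ) : ℝ :=
  kDensity ι z.2 (f z.1)

end Pair

section Zygmund

variable {Θ : Type*} [MeasurableSpace Θ]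

/-- Membership in the Zygmund class `L(log L)^α` over a finite measure space: `g` is measurable and
`∫ |g| (log⁺ |g|)^α < ∞`. -/
def MemLLogL (α : ℝ) (ν : Measure Θ) (g : Θ → ℝ) : Prop :=
  AEStronglyMeasurable g ν ∧
    ∫⁻ z, ENNReal.ofReal (|g z| * (Real.posLog |g z|) ^ α) ∂ν < ∞

/-- The norm of `L(log L)^α` over a finite measure space: the Luxemburg norm of the Young function
`u ↦ u (log (e + u))^α`. -/
def lLogLNorm (α : ℝ) (ν : Measure Θ) (g : Θ → ℝ) : ℝ≥0∞ :=
  ⨅ c ∈ {c : ℝ | 0 < c ∧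
      ∫⁻ z, ENNReal.ofReal (|g z| / c * (Real.log (Real.exp 1 + |g z| / c)) ^ α) ∂ν ≤ 1},
    ENNReal.ofReal c

end Zygmund

end VectorYano

end

open MeasureTheory Set Filter Topology
open scoped ENNReal NNReal

noncomputable section

namespace VectorYano

/-! ### The K-functional, its right derivative, and their joint measurability. -/

section KFunctional

variable {𝕜 A₀ A₁ : Type*} [RCLike 𝕜]
  [NormedAddCommGroup A₀] [NormedSpace 𝕜 A₀] [NormedAddCommGroup A₁] [NormedSpace 𝕜 A₁]
  {ι : A₁ →L[𝕜] A₀} {s t : ℝ} {x y : A₀}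

/-! With `p = p_θ`, the normalization makes the `p`-th power of the `θ`-norm equal to `θ ∫₀^∞
(K(s,x)/s)^p ds`. Since `K(s,x)/s` is the average over `(0,s)` of the decreasing function `k(·,x)`,
and `K(s,x) = ‖x‖` for `s ≥ 1`, everything reduces to comparing `k` on `(0,1)` with its averages.
The levels `λ_n = 2^n - 1` and weights `2^(nα)` discretize the logarithm on both sides.

Bounding the Zygmund norm by the sum norm: `u log(e+u)^α` is at most a constant times `1 + Σ_n
2^(nα) (u - e^{λ_n})₊` (`zygmund_le_tsum`). Superlevel sets of `k(·,x)` are initial intervals, so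
subadditivity of `K` passes to the integrals of these excesses, the level being shared among the
summands in proportion to `θ^{-α}‖f_θ‖` (`lintegral_kDensity_sub_le`). A single summand contributes
at most a multiple of `θ^{-α}‖f_θ‖`: a reverse Hardy inequality with constant one gives `∫₀¹ k^p ≤
‖x‖_θ^p` (`lintegral_kDensity_rpow_le`), and `(1 + log v)^α ≤ C θ^{-α} v^θ` (`one_add_log_rpow_le`)
turns logarithms into powers.

Bounding the sum norm by the Zygmund norm: choose measurably a nearly optimal `a_n(w) ∈ A₁` for
`K(e^{-λ_n}, f(w))`, replaced by zero where `‖f(w)‖` is too large, and telescope `f = Σ (a_{n+1} -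
a_n)`, placing the `n`-th difference at `θ_n = 2^{-(n+1)}`. There `p - 1` is of order `2^{-n}`, so
an `A₁`-norm as large as `e^{2λ_{n+1}}` costs only a constant (`level_rpow_le`), and the `A₀`-norm
is controlled by the remainder `K(e^{-λ_n}, f)`. Summing the weighted remainders produces `∫ k(s) (1
+ log(1/s))^α ds` and a similar term from the truncation, and a Young-type inequality
(`mul_one_add_log_rpow_le`) bounds both by the Zygmund integral. -/

theorem bddBelow_range_kFunctional (ι : A₁ →L[𝕜] A₀) (ht : 0 ≤ t) (x : A₀) :
    BddBelow (range fun a : A₁ => ‖x - ι a‖ + t * ‖a‖) :=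
  ⟨0, by rintro _ ⟨a, rfl⟩; positivity⟩

theorem kFunctional_le (ι : A₁ →L[𝕜] A₀) (ht : 0 ≤ t) (x : A₀) (a : A₁) :
    kFunctional ι t x ≤ ‖x - ι a‖ + t * ‖a‖ :=
  ciInf_le (bddBelow_range_kFunctional ι ht x) a

theorem kFunctional_nonneg (ι : A₁ →L[𝕜] A₀) (ht : 0 ≤ t) (x : A₀) : 0 ≤ kFunctional ι t x :=
  le_ciInf fun a => by positivity

theorem kFunctional_le_norm (ι : A₁ →L[𝕜] A₀) (ht : 0 ≤ t) (x : A₀) : kFunctional ι t x ≤ ‖x‖ := by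
  simpa using kFunctional_le ι ht x 0

theorem kFunctional_zero_right (ι : A₁ →L[𝕜] A₀) (ht : 0 ≤ t) : kFunctional ι t 0 = 0 :=
  le_antisymm (by simpa using kFunctional_le_norm ι ht (0 : A₀)) (kFunctional_nonneg ι ht 0)

theorem kFunctional_mono (ι : A₁ →L[𝕜] A₀) (hs : 0 ≤ s) (hst : s ≤ t) (x : A₀) :
    kFunctional ι s x ≤ kFunctional ι t x :=
  ciInf_mono (bddBelow_range_kFunctional ι hs x) fun a => by gcongr

theorem exists_lt_kFunctional_add (ι : A₁ →L[𝕜] A₀) (t : ℝ) (x : A₀) {ε : ℝ} (hε : 0 < ε) :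
    ∃ a : A₁, ‖x - ι a‖ + t * ‖a‖ < kFunctional ι t x + ε :=
  exists_lt_of_ciInf_lt (lt_add_of_pos_right _ hε)

theorem kFunctional_add_le (ι : A₁ →L[𝕜] A₀) (ht : 0 ≤ t) (x y : A₀) :
    kFunctional ι t (x + y) ≤ kFunctional ι t x + kFunctional ι t y := by
  refine le_of_forall_pos_le_add fun ε hε => ?_
  obtain ⟨a, ha⟩ := exists_lt_kFunctional_add ι t x (half_pos hε)
  obtain ⟨b, hb⟩ := exists_lt_kFunctional_add ι t y (half_pos hε)
  have h := kFunctional_le ι ht (x + y) (a + b)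
  have h1 : ‖x + y - ι (a + b)‖ ≤ ‖x - ι a‖ + ‖y - ι b‖ := by
    rw [map_add, add_sub_add_comm]; exact norm_add_le _ _
  have h2 : t * ‖a + b‖ ≤ t * ‖a‖ + t * ‖b‖ := by
    rw [← mul_add]; exact mul_le_mul_of_nonneg_left (norm_add_le _ _) ht
  linarith

theorem kFunctional_le_add_norm_sub (ι : A₁ →L[𝕜] A₀) (ht : 0 ≤ t) (x y : A₀) :
    kFunctional ι t x ≤ kFunctional ι t y + ‖x - y‖ := by
  have h := kFunctional_add_le ι ht y (x - y)
  rw [add_sub_cancel] at h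
  linarith [kFunctional_le_norm ι ht (x - y)]

theorem kFunctional_sum_le (ι : A₁ →L[𝕜] A₀) (ht : 0 ≤ t) {T : Type*} (F : Finset T) (u : T → A₀) :
    kFunctional ι t (∑ i ∈ F, u i) ≤ ∑ i ∈ F, kFunctional ι t (u i) := by
  classical
  induction F using Finset.induction_on with
  | empty => simp [kFunctional_zero_right ι ht]
  | insert i F hi ih =>
    rw [Finset.sum_insert hi, Finset.sum_insert hi]
    exact (kFunctional_add_le ι ht _ _).trans (by gcongr)

theorem lipschitzWith_kFunctional (ι : A₁ →L[𝕜] A₀) (ht : 0 ≤ t) :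
    LipschitzWith 1 (kFunctional ι t) :=
  LipschitzWith.of_le_add fun x y => by
    rw [dist_eq_norm]; exact kFunctional_le_add_norm_sub ι ht x y

theorem norm_map_le (hι : IsOrderedPair ι) (a : A₁) : ‖ι a‖ ≤ ‖a‖ := by
  simpa using ι.le_of_opNorm_le hι.norm_le_one a

theorem mul_norm_le_kFunctional (hι : IsOrderedPair ι) (ht : 0 ≤ t) (ht1 : t ≤ 1) (x : A₀) :
    t * ‖x‖ ≤ kFunctional ι t x := by
  refine le_ciInf fun a => ?_
  have h1 : ‖x‖ ≤ ‖x - ι a‖ + ‖ι a‖ := by simpa using norm_add_le (x - ι a) (ι a)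
  have h2 := norm_map_le hι a
  nlinarith [norm_nonneg (x - ι a), norm_nonneg a]

/-- Because the inclusion has norm at most one, from time one on no decomposition is cheaper than `a
= 0`. Hence only `k` on `(0,1)` carries information. -/
theorem kFunctional_eq_norm (hι : IsOrderedPair ι) (ht : 1 ≤ t) (x : A₀) :
    kFunctional ι t x = ‖x‖ := by
  refine le_antisymm (kFunctional_le_norm ι (by linarith) x) ?_
  have h := mul_norm_le_kFunctional hι zero_le_one le_rfl x
  rw [one_mul] at h
  exact h.trans (kFunctional_mono ι zero_le_one ht x)

theorem concaveOn_kFunctional (ι : A₁ →L[𝕜] A₀) (x : A₀) :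
    ConcaveOn ℝ (Ici 0) fun t => kFunctional ι t x := by
  refine ⟨convex_Ici 0, fun s hs t ht a b ha hb hab => le_ciInf fun c => ?_⟩
  have h1 := kFunctional_le ι (mem_Ici.1 hs) x c
  have h2 := kFunctional_le ι (mem_Ici.1 ht) x c
  simp only [smul_eq_mul]
  calc a * kFunctional ι s x + b * kFunctional ι t x
      ≤ a * (‖x - ι c‖ + s * ‖c‖) + b * (‖x - ι c‖ + t * ‖c‖) := by gcongr
    _ = (a + b) * ‖x - ι c‖ + (a * s + b * t) * ‖c‖ := by ring
    _ = _ := by rw [hab, one_mul]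

/-- This is where density of `A₁` enters: it excludes a jump of `K(·,x)` at `0`, so that `K` is the
integral of `k` with no boundary term. -/
theorem tendsto_kFunctional_zero (hι : IsOrderedPair ι) (x : A₀) :
    Tendsto (fun t => kFunctional ι t x) (𝓝[≥] 0) (𝓝 0) := by
  rw [Metric.tendsto_nhdsWithin_nhds]
  intro ε hε
  obtain ⟨a, ha⟩ := hι.dense.exists_dist_lt x (half_pos hε)
  rw [dist_eq_norm] at ha
  refine ⟨ε / 2 / (‖a‖ + 1), by positivity, fun t ht htd => ?_⟩
  rw [Real.dist_eq, sub_zero, abs_of_nonneg (mem_Ici.1 ht)] at htd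
  rw [Real.dist_eq, sub_zero, abs_of_nonneg (kFunctional_nonneg ι ht x)]
  have h := kFunctional_le ι (mem_Ici.1 ht) x a
  rw [lt_div_iff₀ (by positivity)] at htd
  nlinarith [norm_nonneg a, mem_Ici.1 ht]

theorem kFunctional_zero_left (hι : IsOrderedPair ι) (x : A₀) : kFunctional ι 0 x = 0 :=
  (tendsto_pure_nhds (fun t => kFunctional ι t x) 0).mono_right le_rfl |> fun h =>
    tendsto_nhds_unique h ((tendsto_kFunctional_zero hι x).mono_left (pure_le_nhdsWithin self_mem_Ici))

theorem continuousOn_kFunctional (hι : IsOrderedPair ι) (x : A₀) :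
    ContinuousOn (fun t => kFunctional ι t x) (Ici 0) := by
  intro t ht
  rcases eq_or_lt_of_le (mem_Ici.1 ht) with rfl | h
  · simpa only [ContinuousWithinAt, kFunctional_zero_left hι] using tendsto_kFunctional_zero hι x
  · have := (concaveOn_kFunctional ι x).continuousOn_interior
    rw [interior_Ici] at this
    exact (this.continuousAt (Ioi_mem_nhds h)).continuousWithinAt

theorem hasDerivWithinAt_kFunctional (ι : A₁ →L[𝕜] A₀) (hs : 0 < s) (x : A₀) :
    HasDerivWithinAt (fun t => kFunctional ι t x) (kDensity ι s x) (Ioi s) s := by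
  have h := (concaveOn_kFunctional ι x).neg.differentiableWithinAt_Ioi_of_mem_interior
    (x := s) (by rwa [interior_Ici])
  have h' : DifferentiableWithinAt ℝ (fun t => kFunctional ι t x) (Ioi s) s := by
    simpa only [neg_neg] using h.neg
  exact h'.hasDerivWithinAt

theorem antitoneOn_kDensity (ι : A₁ →L[𝕜] A₀) (x : A₀) :
    AntitoneOn (fun s => kDensity ι s x) (Ioi 0) := by
  have h := (concaveOn_kFunctional ι x).neg.monotoneOn_rightDeriv
  rw [interior_Ici] at h
  intro s hs t ht hst
  have h' := h hs ht hst
  have e : ∀ r ∈ Ioi (0 : ℝ), derivWithin (-fun t => kFunctional ι t x) (Ioi r) r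
      = -kDensity ι r x := fun r hr =>
    (hasDerivWithinAt_kFunctional ι hr x).neg.derivWithin (uniqueDiffWithinAt_Ioi r)
  simp only [e s hs, e t ht] at h'
  exact neg_le_neg_iff.1 h'

theorem kDensity_nonneg (ι : A₁ →L[𝕜] A₀) (hs : 0 < s) (x : A₀) : 0 ≤ kDensity ι s x := by
  have h := (hasDerivWithinAt_kFunctional ι hs x)
  rw [hasDerivWithinAt_iff_tendsto_slope' self_notMem_Ioi] at h
  refine ge_of_tendsto h ?_
  filter_upwards [self_mem_nhdsWithin] with t ht
  rw [slope_def_field]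
  exact div_nonneg (sub_nonneg.2 (kFunctional_mono ι hs.le (mem_Ioi.1 ht).le x))
    (sub_nonneg.2 (mem_Ioi.1 ht).le)

theorem intervalIntegrable_kDensity (hι : IsOrderedPair ι) (ht : 0 ≤ t) (x : A₀) :
    IntervalIntegrable (fun s => kDensity ι s x) volume 0 t := by
  rw [intervalIntegrable_iff_integrableOn_Ioc_of_le ht]
  exact intervalIntegral.integrableOn_deriv_right_of_nonneg
    ((continuousOn_kFunctional hι x).mono Icc_subset_Ici_self)
    (fun s hs => hasDerivWithinAt_kFunctional ι hs.1 x) fun s hs => kDensity_nonneg ι hs.1 x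

theorem integral_kDensity (hι : IsOrderedPair ι) (ht : 0 ≤ t) (x : A₀) :
    ∫ s in (0)..t, kDensity ι s x = kFunctional ι t x := by
  rw [intervalIntegral.integral_eq_sub_of_hasDeriv_right_of_le ht
    ((continuousOn_kFunctional hι x).mono Icc_subset_Ici_self)
    (fun s hs => hasDerivWithinAt_kFunctional ι hs.1 x) (intervalIntegrable_kDensity hι ht x),
    kFunctional_zero_left hι, sub_zero]

theorem lintegral_kDensity (hι : IsOrderedPair ι) (ht : 0 ≤ t) (x : A₀) :
    ∫⁻ s in Ioo 0 t, ENNReal.ofReal (kDensity ι s x) = ENNReal.ofReal (kFunctional ι t x) := by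
  rw [← integral_kDensity hι ht, intervalIntegral.integral_of_le ht,
    setLIntegral_congr Ioo_ae_eq_Ioc, ofReal_integral_eq_lintegral_ofReal]
  · exact (intervalIntegrable_iff_integrableOn_Ioc_of_le ht).1 (intervalIntegrable_kDensity hι ht x)
  · filter_upwards [ae_restrict_mem measurableSet_Ioc] with s hs using kDensity_nonneg ι hs.1 x

theorem mul_kDensity_le (hι : IsOrderedPair ι) (hs : 0 < s) (x : A₀) :
    s * kDensity ι s x ≤ kFunctional ι s x := by
  rw [← integral_kDensity hι hs.le]
  have h : ∫ _ in (0)..s, kDensity ι s x ≤ ∫ r in (0)..s, kDensity ι r x := by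
    refine intervalIntegral.integral_mono_on_of_le_Ioo hs.le (by simp)
      (intervalIntegrable_kDensity hι hs.le x) fun r hr => ?_
    exact antitoneOn_kDensity ι x hr.1 hs hr.2.le
  simpa using h

variable {Ω : Type*} [MeasurableSpace Ω]

/-- A Carathéodory argument: continuous in the time, measurable in the point. The `max` freezes `K`
at its value at time zero for negative times, so that continuity holds on the whole line. -/
theorem stronglyMeasurable_kFunctional (hι : IsOrderedPair ι) {f : Ω → A₀}
    (hf : StronglyMeasurable f) :
    StronglyMeasurable fun z : Ω × ℝ => kFunctional ι (max z.2 0) (f z.1) := by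
  have h := stronglyMeasurable_uncurry_of_continuous_of_stronglyMeasurable
    (u := fun (s : ℝ) (w : Ω) => kFunctional ι (max s 0) (f w))
    (fun w => (continuousOn_kFunctional hι (f w)).comp_continuous
      (continuous_id.max continuous_const) fun s => mem_Ici.2 (le_max_right _ _))
    fun s => (lipschitzWith_kFunctional ι (le_max_right s 0)).continuous.comp_stronglyMeasurable hf
  exact h.comp_measurable measurable_swap

/-- The right derivative is the limit of difference quotients of `K` with steps `1/(n+1)`, each
jointly measurable. -/
theorem aestronglyMeasurable_Psi (hι : IsOrderedPair ι) {f : Ω → A₀}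
    (hf : StronglyMeasurable f) (μ : Measure Ω) [SFinite μ] :
    AEStronglyMeasurable (Psi ι f) (μ.prod (volume.restrict (Ioo (0 : ℝ) 1))) := by
  have hK := stronglyMeasurable_kFunctional hι hf
  have hδ : Tendsto (fun n : ℕ => (1 : ℝ) / (n + 1)) atTop (𝓝 0) :=
    tendsto_one_div_add_atTop_nhds_zero_nat
  refine aestronglyMeasurable_of_tendsto_ae atTop
    (f := fun (n : ℕ) (z : Ω × ℝ) => ((1 : ℝ) / (n + 1))⁻¹ *
      (kFunctional ι (max (z.2 + 1 / (n + 1)) 0) (f z.1) - kFunctional ι (max z.2 0) (f z.1)))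
    (fun n => ?_) ?_
  · refine (((hK.comp_measurable (g := fun z : Ω × ℝ => (z.1, z.2 + 1 / ((n : ℝ) + 1)))
      (by fun_prop)).sub hK).const_mul _).aestronglyMeasurable
  · have h0 : ∀ᵐ z ∂(μ.prod (volume.restrict (Ioo (0 : ℝ) 1))), z.2 ∈ Ioo (0 : ℝ) 1 :=
      Measure.quasiMeasurePreserving_snd.ae (ae_restrict_mem measurableSet_Ioo)
    filter_upwards [h0] with z hz
    have h := (hasDerivWithinAt_iff_tendsto_slope' self_notMem_Ioi).1
      (hasDerivWithinAt_kFunctional ι hz.1 (f z.1))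
    have h2 : Tendsto (fun n : ℕ => z.2 + (1 : ℝ) / (n + 1)) atTop (𝓝[>] z.2) := by
      refine tendsto_nhdsWithin_iff.2 ⟨by simpa using hδ.const_add z.2, .of_forall fun n => ?_⟩
      have : (0 : ℝ) < 1 / (n + 1) := by positivity
      simpa using this
    refine (h.comp h2).congr fun n => ?_
    have : (0 : ℝ) < 1 / (n + 1) := by positivity
    rw [Function.comp_apply, slope_def_field, max_eq_left hz.1.le, max_eq_left (by linarith [hz.1]),
      add_sub_cancel_left, div_eq_inv_mul]

end KFunctional

/-! ### The norm of the interpolation space as an average, and the reverse Hardy inequality. -/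

section InterpolationNorm

variable {𝕜 A₀ A₁ : Type*} [RCLike 𝕜]
  [NormedAddCommGroup A₀] [NormedSpace 𝕜 A₀] [NormedAddCommGroup A₁] [NormedSpace 𝕜 A₁]
  {ι : A₁ →L[𝕜] A₀} {θ : ℝ} {x : A₀}

theorem one_lt_pExp (hθ : θ ∈ Ioo (0 : ℝ) 1) : 1 < pExp θ := by
  rw [pExp, lt_div_iff₀ (by linarith [hθ.2])]; linarith [hθ.1]

theorem pExp_sub_one (hθ : θ ∈ Ioo (0 : ℝ) 1) : pExp θ - 1 = θ * pExp θ := by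
  have : 1 - θ ≠ 0 := by linarith [hθ.2]
  rw [pExp]; field_simp; ring

theorem one_div_pExp (θ : ℝ) : 1 / pExp θ = 1 - θ := by rw [pExp, one_div_one_div]

/-- The `p_θ`-th power of the norm of `(A₀, A₁)_{θ,p_θ}`: up to the factor `θ`, the integral of the
`p_θ`-th power of the averages `K(s, x) / s`. -/
def averagePow (ι : A₁ →L[𝕜] A₀) (θ : ℝ) (x : A₀) : ℝ≥0∞ :=
  ENNReal.ofReal θ * ∫⁻ s in Ioi (0 : ℝ), ENNReal.ofReal ((kFunctional ι s x / s) ^ pExp θ)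

/-- For `p = 1/(1-θ)` one has `pθ(1-θ) = θ` and `θp = p - 1`, so the weight `s^{-θp} ds/s` is
exactly `s^{-p} ds`. -/
theorem interpNorm_eq (ι : A₁ →L[𝕜] A₀) (hθ : θ ∈ Ioo (0 : ℝ) 1) (x : A₀) :
    interpNorm ι θ (pExp θ) x = averagePow ι θ x ^ (1 / pExp θ) := by
  have hp := one_lt_pExp hθ
  have hp0 : (0 : ℝ) ≤ 1 / pExp θ := by positivity
  rw [averagePow, ENNReal.mul_rpow_of_nonneg _ _ hp0, interpNorm,
    ENNReal.ofReal_rpow_of_nonneg hθ.1.le hp0]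
  have h1 : pExp θ * θ * (1 - θ) = θ := by
    have : 1 - θ ≠ 0 := by linarith [hθ.2]
    rw [pExp]; field_simp
  rw [h1]
  congr 2
  refine setLIntegral_congr_fun measurableSet_Ioi fun s hs => ?_
  have hs : 0 < s := hs
  have hK := kFunctional_nonneg ι hs.le x
  rw [Real.mul_rpow (by positivity) hK, Real.div_rpow hK hs.le, ← Real.rpow_mul hs.le]
  have h2 : -θ * pExp θ = 1 - pExp θ := by linarith [pExp_sub_one hθ]
  rw [h2, Real.rpow_sub hs, Real.rpow_one]
  congr 1
  field_simp

theorem interpNorm_rpow (ι : A₁ →L[𝕜] A₀) (hθ : θ ∈ Ioo (0 : ℝ) 1) (x : A₀) :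
    interpNorm ι θ (pExp θ) x ^ pExp θ = averagePow ι θ x := by
  have hp := one_lt_pExp hθ
  rw [interpNorm_eq ι hθ, ← ENNReal.rpow_mul, one_div_mul_cancel (by positivity), ENNReal.rpow_one]

theorem vectorLpNorm_eq {Ω : Type*} [MeasurableSpace Ω] (ι : A₁ →L[𝕜] A₀)
    (hθ : θ ∈ Ioo (0 : ℝ) 1) (μ : Measure Ω) (f : Ω → A₀) :
    vectorLpNorm ι θ (pExp θ) (pExp θ) μ f = (∫⁻ w, averagePow ι θ (f w) ∂μ) ^ (1 / pExp θ) := by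
  simp only [vectorLpNorm, interpNorm_rpow ι hθ]

theorem interpNorm_zero (ι : A₁ →L[𝕜] A₀) (hθ : θ ∈ Ioo (0 : ℝ) 1) :
    interpNorm ι θ (pExp θ) (0 : A₀) = 0 := by
  have hp := one_lt_pExp hθ
  have h : ∫⁻ s in Ioi (0 : ℝ), ENNReal.ofReal ((kFunctional ι s (0 : A₀) / s) ^ pExp θ) = 0 := by
    rw [setLIntegral_congr_fun (g := fun _ => 0) measurableSet_Ioi fun s hs => ?_, lintegral_zero]
    simp only
    rw [kFunctional_zero_right ι (mem_Ioi.1 hs).le, zero_div, Real.zero_rpow (by positivity),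
      ENNReal.ofReal_zero]
  rw [interpNorm_eq ι hθ, averagePow, h, mul_zero, ENNReal.zero_rpow_of_pos (by positivity)]

theorem lintegral_Ioi_div_rpow {p X c : ℝ} (hp : 1 < p) (hX : 0 ≤ X) (hc : 0 < c) :
    ∫⁻ s in Ioi c, ENNReal.ofReal ((X / s) ^ p) = ENNReal.ofReal (X ^ p * (c ^ (1 - p) / (p - 1))) := by
  have h1 : ∫⁻ s in Ioi c, ENNReal.ofReal ((X / s) ^ p)
      = ∫⁻ s in Ioi c, ENNReal.ofReal (X ^ p * s ^ (-p)) := by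
    refine setLIntegral_congr_fun measurableSet_Ioi fun s hs => ?_
    have hs : 0 < s := hc.trans hs
    rw [Real.div_rpow hX hs.le, Real.rpow_neg hs.le, div_eq_mul_inv]
  rw [h1, ← ofReal_integral_eq_lintegral_ofReal, integral_const_mul,
    integral_Ioi_rpow_of_lt (by linarith) hc]
  · congr 2
    rw [show -p + 1 = -(p - 1) by ring, neg_div_neg_eq, show -(p - 1) = 1 - p by ring]
  · exact (integrableOn_Ioi_rpow_of_lt (by linarith) hc).const_mul _
  · filter_upwards [ae_restrict_mem measurableSet_Ioi] with s hs
    have hs : 0 < s := hc.trans hs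
    positivity

/-- The two bounds on `K` cross at `s = X₀/X₁`. Splitting there gives `X₀ X₁^(p-1) (1 + 1/(p-1))`,
and the factor `θ = (p-1)/p` cancels the bracket, so the bound is uniform in `θ`. -/
theorem averagePow_le (hθ : θ ∈ Ioo (0 : ℝ) 1) {X₀ X₁ : ℝ} (hX₀ : 0 ≤ X₀) (hX₁ : 0 ≤ X₁)
    (h₀ : ∀ s, 0 < s → kFunctional ι s x ≤ X₀) (h₁ : ∀ s, 0 < s → kFunctional ι s x ≤ s * X₁) :
    averagePow ι θ x ≤ ENNReal.ofReal (X₀ * X₁ ^ (pExp θ - 1)) := by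
  have hp := one_lt_pExp hθ
  have hpθ := pExp_sub_one hθ
  have hθ0 := hθ.1
  set p := pExp θ with hpdef
  by_cases hz : X₀ = 0 ∨ X₁ = 0
  · have h : ∫⁻ s in Ioi (0 : ℝ), ENNReal.ofReal ((kFunctional ι s x / s) ^ p) = 0 := by
      rw [setLIntegral_congr_fun (g := fun _ => 0) measurableSet_Ioi fun s hs => ?_, lintegral_zero]
      have hK : kFunctional ι s x = 0 := by
        refine le_antisymm ?_ (kFunctional_nonneg ι (mem_Ioi.1 hs).le x)
        rcases hz with hz | hz
        · exact (h₀ s hs).trans hz.le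
        · simpa [hz] using h₁ s hs
      simp only
      rw [hK, zero_div, Real.zero_rpow (by positivity), ENNReal.ofReal_zero]
    rw [averagePow, ← hpdef, h, mul_zero]; exact zero_le
  push Not at hz
  have hX₀ : 0 < X₀ := lt_of_le_of_ne hX₀ hz.1.symm
  have hX₁ : 0 < X₁ := lt_of_le_of_ne hX₁ hz.2.symm
  set c := X₀ / X₁ with hc
  have hc0 : 0 < c := by positivity
  have hsplit : Ioi (0 : ℝ) = Ioc 0 c ∪ Ioi c := (Ioc_union_Ioi_eq_Ioi hc0.le).symm
  have hA : ∫⁻ s in Ioc 0 c, ENNReal.ofReal ((kFunctional ι s x / s) ^ p)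
      ≤ ENNReal.ofReal (X₀ * X₁ ^ (p - 1)) := by
    calc _ ≤ ∫⁻ _ in Ioc 0 c, ENNReal.ofReal (X₁ ^ p) := by
          refine setLIntegral_mono measurable_const fun s hs => ?_
          have hs0 : 0 < s := hs.1
          have hK := kFunctional_nonneg ι hs0.le x
          gcongr
          rw [div_le_iff₀' hs0]
          exact h₁ s hs0
      _ = ENNReal.ofReal (X₀ * X₁ ^ (p - 1)) := by
          rw [setLIntegral_const, Real.volume_Ioc, sub_zero, ← ENNReal.ofReal_mul (by positivity),
            Real.rpow_sub_one hX₁.ne']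
          congr 1
          rw [hc]; field_simp
  have hB : ∫⁻ s in Ioi c, ENNReal.ofReal ((kFunctional ι s x / s) ^ p)
      ≤ ENNReal.ofReal (X₀ * X₁ ^ (p - 1) / (p - 1)) := by
    calc _ ≤ ∫⁻ s in Ioi c, ENNReal.ofReal ((X₀ / s) ^ p) := by
          refine setLIntegral_mono (by fun_prop) fun s hs => ?_
          have hs0 : 0 < s := hc0.trans hs
          have hK := kFunctional_nonneg ι hs0.le x
          gcongr
          exact h₀ s hs0
      _ = _ := by
          rw [lintegral_Ioi_div_rpow hp hX₀.le hc0, hc, Real.div_rpow hX₀.le hX₁.le,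
            show 1 - p = -(p - 1) by ring, Real.rpow_neg hX₁.le, Real.rpow_neg hX₀.le,
            show X₀ ^ p = X₀ * X₀ ^ (p - 1) by
              rw [Real.rpow_sub_one hX₀.ne']; field_simp]
          congr 1
          have := Real.rpow_pos_of_pos hX₀ (p - 1)
          field_simp
  rw [averagePow, ← hpdef, hsplit, lintegral_union measurableSet_Ioi
    (Ioc_disjoint_Ioi le_rfl)]
  refine (mul_le_mul_right (add_le_add hA hB) _).trans ?_
  have hp1 : 0 < p - 1 := by linarith
  rw [← ENNReal.ofReal_add (by positivity) (by positivity), ← ENNReal.ofReal_mul hθ0.le]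
  refine ENNReal.ofReal_le_ofReal (le_of_eq ?_)
  have : θ = (p - 1) / p := by rw [hpθ]; field_simp
  rw [this]
  field_simp
  ring

/-- Integrate the derivative of `s^(1-p) K^p` over `(a,1)`. Staying away from `0` makes every
integral finite without assuming that `x` lies in the interpolation space. -/
theorem lintegral_Ioo_kDensity_rpow_le (hι : IsOrderedPair ι) (hθ : θ ∈ Ioo (0 : ℝ) 1) (x : A₀)
    {a : ℝ} (ha : a ∈ Ioo (0 : ℝ) 1) :
    ∫⁻ s in Ioo a 1, ENNReal.ofReal (kDensity ι s x ^ pExp θ) ≤ averagePow ι θ x := by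
  have hp := one_lt_pExp hθ
  have hpθ := pExp_sub_one hθ
  have hθ0 := hθ.1
  rw [averagePow]
  set p := pExp θ with hpdef
  have hpos : ∀ s ∈ Icc a 1, 0 < s := fun s hs => ha.1.trans_le hs.1
  have hKc : ContinuousOn (fun s => kFunctional ι s x) (Icc a 1) :=
    (continuousOn_kFunctional hι x).mono fun s hs => (hpos s hs).le
  have hc1 : ContinuousOn (fun s => (kFunctional ι s x / s) ^ p) (Icc a 1) :=
    (hKc.div continuousOn_id fun s hs => (hpos s hs).ne').rpow_const fun _ _ => Or.inr (by linarith)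
  have hi1 : IntegrableOn (fun s => (kFunctional ι s x / s) ^ p) (Icc a 1) :=
    hc1.integrableOn_compact isCompact_Icc
  have hi2 : IntegrableOn (fun s => kDensity ι s x ^ p) (Icc a 1) := by
    refine AntitoneOn.integrableOn_isCompact isCompact_Icc fun s hs t ht hst => ?_
    have := kDensity_nonneg ι (hpos t ht) x
    exact Real.rpow_le_rpow this
      (antitoneOn_kDensity ι x (hpos s hs) (hpos t ht) hst) (by linarith)
  have hG : ContinuousOn (fun s => s ^ (1 - p) * kFunctional ι s x ^ p) (Icc a 1) :=
    (continuousOn_id.rpow_const fun s hs => Or.inl (hpos s hs).ne').mul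
      (hKc.rpow_const fun _ _ => Or.inr (by linarith))
  -- The derivative is `p k (K/s)^(p-1) - (p-1) (K/s)^p`, which is at least `φ = p k^p - (p-1)
  -- (K/s)^p` because `k ≤ K/s`.
  have key := intervalIntegral.integral_le_sub_of_hasDeriv_right_of_le
    (g' := fun s => (1 - p) * s ^ (1 - p - 1) * kFunctional ι s x ^ p
      + s ^ (1 - p) * (kDensity ι s x * p * kFunctional ι s x ^ (p - 1)))
    (φ := fun s => p * kDensity ι s x ^ p - (p - 1) * (kFunctional ι s x / s) ^ p) ha.2.le hG
    (fun s hs => ?_) ((hi2.const_mul p).sub (hi1.const_mul (p - 1))) fun s hs => ?_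
  rotate_left
  · have hs0 : 0 < s := hpos s (Ioo_subset_Icc_self hs)
    exact (Real.hasDerivAt_rpow_const (Or.inl hs0.ne')).hasDerivWithinAt.mul
      ((hasDerivWithinAt_kFunctional ι hs0 x).rpow_const (Or.inr hp.le))
  · have hs0 : 0 < s := hpos s (Ioo_subset_Icc_self hs)
    have hk := kDensity_nonneg ι hs0 x
    have hK := kFunctional_nonneg ι hs0.le x
    have h1 : kDensity ι s x ^ p ≤ kDensity ι s x * (kFunctional ι s x / s) ^ (p - 1) := by
      rcases hk.eq_or_lt with h | h
      · rw [← h, Real.zero_rpow (by linarith), zero_mul]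
      · rw [show kDensity ι s x ^ p = kDensity ι s x * kDensity ι s x ^ (p - 1) by
          rw [Real.rpow_sub_one h.ne']; field_simp]
        have h0 : kDensity ι s x ≤ kFunctional ι s x / s := by
          rw [le_div_iff₀' hs0]; exact mul_kDensity_le hι hs0 x
        exact mul_le_mul_of_nonneg_left (Real.rpow_le_rpow hk h0 (by linarith)) hk
    rw [Real.div_rpow hK hs0.le] at h1 ⊢
    have h2 : s ^ (1 - p - 1) = (s ^ p)⁻¹ := by
      rw [← Real.rpow_neg hs0.le]; congr 1; ring
    have h3 : s ^ (1 - p) = (s ^ (p - 1))⁻¹ := by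
      rw [← Real.rpow_neg hs0.le]; congr 1; ring
    rw [h2, h3]
    have h4 := mul_le_mul_of_nonneg_left h1 (show 0 ≤ p by linarith)
    have h5 : p * (kDensity ι s x * (kFunctional ι s x ^ (p - 1) / s ^ (p - 1)))
      = (s ^ (p - 1))⁻¹ * (kDensity ι s x * p * kFunctional ι s x ^ (p - 1)) := by
      rw [div_eq_mul_inv]; ring
    rw [div_eq_mul_inv]
    linarith
  have hii : ∀ {g : ℝ → ℝ}, IntegrableOn g (Icc a 1) → IntervalIntegrable g volume a 1 :=
    fun h => (intervalIntegrable_iff_integrableOn_Icc_of_le ha.2.le).2 h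
  rw [intervalIntegral.integral_sub ((hii hi2).const_mul _) ((hii hi1).const_mul _),
    intervalIntegral.integral_const_mul, intervalIntegral.integral_const_mul,
    kFunctional_eq_norm hι le_rfl, Real.one_rpow, one_mul] at key
  have hGa : 0 ≤ a ^ (1 - p) * kFunctional ι a x ^ p := by
    have := kFunctional_nonneg ι ha.1.le x
    have := ha.1
    positivity
  -- The boundary value at `a` is nonnegative and is dropped. The value `‖x‖^p` at `1`, divided by
  -- `p - 1`, is exactly the integral of `(K/s)^p` over `(1,∞)`, so the part of the norm beyond `1`
  -- absorbs it.
  have key2 : ∫ s in a..1, kDensity ι s x ^ p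
      ≤ θ * ((∫ s in a..1, (kFunctional ι s x / s) ^ p) + ‖x‖ ^ p * (1 / (p - 1))) := by
    have hp1 : 0 < p - 1 := by linarith
    have e : θ = (p - 1) / p := by rw [hpθ]; field_simp
    rw [e, div_mul_eq_mul_div, le_div_iff₀ (by linarith), mul_add, mul_comm (‖x‖ ^ p), ← mul_assoc,
      mul_one_div_cancel hp1.ne']
    linarith
  have hsub : Ioc a 1 ∪ Ioi 1 ⊆ Ioi (0 : ℝ) := by
    rw [Ioc_union_Ioi_eq_Ioi ha.2.le]; exact Ioi_subset_Ioi ha.1.le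
  have hL : ∫⁻ s in Ioo a 1, ENNReal.ofReal (kDensity ι s x ^ p)
      = ENNReal.ofReal (∫ s in a..1, kDensity ι s x ^ p) := by
    rw [setLIntegral_congr Ioo_ae_eq_Ioc, intervalIntegral.integral_of_le ha.2.le,
      ofReal_integral_eq_lintegral_ofReal (hi2.mono_set Ioc_subset_Icc_self)]
    filter_upwards [ae_restrict_mem measurableSet_Ioc] with s hs
    exact Real.rpow_nonneg (kDensity_nonneg ι (ha.1.trans hs.1) x) _
  have hR : ∫⁻ s in Ioc a 1, ENNReal.ofReal ((kFunctional ι s x / s) ^ p)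
      = ENNReal.ofReal (∫ s in a..1, (kFunctional ι s x / s) ^ p) := by
    rw [intervalIntegral.integral_of_le ha.2.le,
      ofReal_integral_eq_lintegral_ofReal (hi1.mono_set Ioc_subset_Icc_self)]
    filter_upwards [ae_restrict_mem measurableSet_Ioc] with s hs
    have hs0 := ha.1.trans hs.1
    have := kFunctional_nonneg ι hs0.le x
    positivity
  have hT : ∫⁻ s in Ioi 1, ENNReal.ofReal ((kFunctional ι s x / s) ^ p)
      = ENNReal.ofReal (‖x‖ ^ p * (1 / (p - 1))) := by
    have h := lintegral_Ioi_div_rpow hp (norm_nonneg x) one_pos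
    rw [Real.one_rpow] at h
    rw [← h]
    refine setLIntegral_congr_fun measurableSet_Ioi fun s hs => ?_
    rw [kFunctional_eq_norm hι (mem_Ioi.1 hs).le]
  refine le_trans ?_ (mul_le_mul_right (lintegral_mono_set hsub) _)
  rw [lintegral_union measurableSet_Ioi (Ioc_disjoint_Ioi le_rfl), hL, hR, hT,
    ← ENNReal.ofReal_add, ← ENNReal.ofReal_mul hθ0.le]
  · exact ENNReal.ofReal_le_ofReal key2
  · refine intervalIntegral.integral_nonneg ha.2.le fun s hs => ?_
    have hs0 := hpos s hs
    have := kFunctional_nonneg ι hs0.le x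
    positivity
  · have hp1 : 0 < p - 1 := by linarith
    positivity

/-- A sharp reverse Hardy inequality for the decreasing function `k(·, x)`. -/
theorem lintegral_kDensity_rpow_le (hι : IsOrderedPair ι) (hθ : θ ∈ Ioo (0 : ℝ) 1) (x : A₀) :
    ∫⁻ s in Ioo 0 1, ENNReal.ofReal (kDensity ι s x ^ pExp θ) ≤ averagePow ι θ x := by
  have hU : Ioo (0 : ℝ) 1 = ⋃ n : ℕ, Ioo ((1 : ℝ) / (n + 2)) 1 := by
    ext s
    simp only [mem_Ioo, mem_iUnion]
    refine ⟨fun h => ?_, fun ⟨n, h⟩ => ⟨lt_trans (by positivity) h.1, h.2⟩⟩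
    obtain ⟨n, hn⟩ := exists_nat_one_div_lt h.1
    exact ⟨n, lt_of_le_of_lt (by gcongr; norm_num) hn, h.2⟩
  have hmono : Monotone fun n : ℕ => Ioo ((1 : ℝ) / (n + 2)) 1 := fun m n hmn =>
    Ioo_subset_Ioo_left (by gcongr)
  rw [hU, setLIntegral_iUnion_of_directed _ hmono.directed_le]
  refine iSup_le fun n => lintegral_Ioo_kDensity_rpow_le hι hθ x ⟨by positivity, ?_⟩
  rw [div_lt_one (by positivity)]
  have : (0 : ℝ) ≤ n := n.cast_nonneg
  linarith

end InterpolationNorm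

/-! ### Scalar inequalities: dyadic levels and weights against logarithms. -/

section Scalar

/-- The exponents `2 ^ n - 1`; the dyadic levels are their exponentials. -/
def dyadicLevel (n : ℕ) : ℝ := 2 ^ n - 1

/-- The weights `2 ^ (n α)`. -/
def dyadicWeight (α : ℝ) (n : ℕ) : ℝ≥0∞ := ENNReal.ofReal (((2 : ℝ) ^ n) ^ α)

/-- The Young function `u (log (e + u))^α`. -/
def zygmund (α u : ℝ) : ℝ := u * Real.log (Real.exp 1 + u) ^ α

variable {α : ℝ}

theorem dyadicLevel_nonneg (n : ℕ) : 0 ≤ dyadicLevel n :=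
  sub_nonneg.2 (one_le_pow₀ one_le_two)

theorem dyadicLevel_mono : Monotone dyadicLevel := fun m n h => by
  unfold dyadicLevel; gcongr; exact one_le_two

theorem dyadicLevel_zero : dyadicLevel 0 = 0 := by simp [dyadicLevel]

/-- A constant in the summation of the dyadic weights below a given level. -/
def dyadicConst (α : ℝ) : ℝ := 2 ^ α / (2 ^ α - 1)

theorem dyadicConst_pos (hα : 0 < α) : 0 < dyadicConst α :=
  div_pos (by positivity) (sub_pos.2 (Real.one_lt_rpow one_lt_two hα))

theorem two_pow_log_floor_le {y : ℝ} (hy : 1 ≤ y) : (2 : ℝ) ^ Nat.log 2 ⌊y⌋₊ ≤ y := by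
  have h := Nat.pow_log_le_self 2 (Nat.floor_pos.2 hy).ne'
  calc (2 : ℝ) ^ Nat.log 2 ⌊y⌋₊ = ((2 ^ Nat.log 2 ⌊y⌋₊ : ℕ) : ℝ) := by push_cast; rfl
    _ ≤ (⌊y⌋₊ : ℝ) := by exact_mod_cast h
    _ ≤ y := Nat.floor_le (by linarith)

theorem lt_two_pow_log_floor_succ (y : ℝ) : y < (2 : ℝ) ^ (Nat.log 2 ⌊y⌋₊ + 1) := by
  have h := Nat.lt_pow_succ_log_self one_lt_two ⌊y⌋₊
  have h2 := Nat.lt_of_floor_lt h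
  exact_mod_cast h2

/-- The condition says `2^n < 1 + y`, so this is a geometric sum of ratio `2^α > 1`, dominated by
its last term. -/
theorem tsum_dyadicWeight_le (hα : 0 < α) {y : ℝ} (hy : 0 ≤ y) :
    ∑' n, (if dyadicLevel n < y then dyadicWeight α n else 0)
      ≤ ENNReal.ofReal (dyadicConst α * (1 + y) ^ α) := by
  set m := Nat.log 2 ⌊1 + y⌋₊ with hm
  have hr : 1 < (2 : ℝ) ^ α := Real.one_lt_rpow one_lt_two hα
  have hpow : ∀ n : ℕ, ((2 : ℝ) ^ n) ^ α = ((2 : ℝ) ^ α) ^ n := fun n => by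
    rw [← Real.rpow_natCast, ← Real.rpow_mul zero_le_two, mul_comm, Real.rpow_mul zero_le_two,
      Real.rpow_natCast]
  rw [tsum_eq_sum (s := Finset.range (m + 1)) fun n hn => ?_]
  · calc _ ≤ ∑ n ∈ Finset.range (m + 1), dyadicWeight α n :=
          Finset.sum_le_sum fun n _ => by split_ifs <;> simp
      _ = ENNReal.ofReal (∑ n ∈ Finset.range (m + 1), ((2 : ℝ) ^ α) ^ n) := by
          rw [ENNReal.ofReal_sum_of_nonneg fun _ _ => by positivity]
          simp only [dyadicWeight, hpow]
      _ ≤ _ := by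
          refine ENNReal.ofReal_le_ofReal ?_
          rw [geom_sum_eq hr.ne', dyadicConst, div_mul_eq_mul_div]
          have h1 : ((2 : ℝ) ^ α) ^ m ≤ (1 + y) ^ α := by
            rw [← hpow]
            exact Real.rpow_le_rpow (by positivity) (two_pow_log_floor_le (by linarith)) hα.le
          have : 0 < (2 : ℝ) ^ α - 1 := by linarith
          gcongr
          rw [pow_succ]
          nlinarith
  · refine if_neg fun h => ?_
    simp only [Finset.mem_range, not_lt] at hn
    have h2 : (2 : ℝ) ^ (m + 1) ≤ 2 ^ n := pow_le_pow_right₀ one_le_two hn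
    have h3 := lt_two_pow_log_floor_succ (1 + y)
    rw [dyadicLevel] at h
    linarith

/-- Apply `log z ≤ z` to `z = v^(θ/α)` and raise to the power `α`. The loss `θ^{-α}` is precisely
the weight of the extrapolation space. -/
theorem one_add_log_rpow_le (hα : 0 < α) {θ v : ℝ} (hθ : 0 < θ) (hθ1 : θ ≤ 1) (hv : 1 ≤ v) :
    (1 + Real.log v) ^ α ≤ (α + 1) ^ α * θ ^ (-α) * v ^ θ := by
  have hv0 : 0 < v := by linarith
  have h1 : Real.log v = α / θ * Real.log (v ^ (θ / α)) := by
    rw [Real.log_rpow hv0]; field_simp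
  have hl := Real.log_nonneg hv
  have h2 : Real.log (v ^ (θ / α)) ≤ v ^ (θ / α) := by
    have := Real.log_le_sub_one_of_pos (Real.rpow_pos_of_pos hv0 (θ / α)); linarith
  have h3 : 1 ≤ v ^ (θ / α) := Real.one_le_rpow hv (by positivity)
  have h4 : 1 + Real.log v ≤ (α + 1) * θ⁻¹ * v ^ (θ / α) := by
    have h5 : 1 ≤ θ⁻¹ := (one_le_inv₀ hθ).2 hθ1
    have h6 : Real.log v ≤ α / θ * v ^ (θ / α) := h1.le.trans (by gcongr)
    have h7 : 1 ≤ θ⁻¹ * v ^ (θ / α) := by nlinarith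
    calc 1 + Real.log v ≤ θ⁻¹ * v ^ (θ / α) + α / θ * v ^ (θ / α) := by linarith
      _ = _ := by ring
  calc (1 + Real.log v) ^ α ≤ ((α + 1) * θ⁻¹ * v ^ (θ / α)) ^ α :=
        Real.rpow_le_rpow (by linarith) h4 hα.le
    _ = _ := by
        rw [Real.mul_rpow (by positivity) (by positivity), Real.mul_rpow (by positivity)
          (by positivity), ← Real.rpow_mul hv0.le, Real.inv_rpow hθ.le, ← Real.rpow_neg hθ.le,
          div_mul_cancel₀ _ hα.ne']

theorem one_le_log_exp_one_add {u : ℝ} (hu : 0 ≤ u) : 1 ≤ Real.log (Real.exp 1 + u) := by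
  rw [Real.le_log_iff_exp_le (by positivity)]; linarith

theorem zygmund_nonneg {u : ℝ} (hu : 0 ≤ u) : 0 ≤ zygmund α u :=
  mul_nonneg hu (Real.rpow_nonneg (zero_le_one.trans (one_le_log_exp_one_add hu)) _)

theorem self_le_zygmund (hα : 0 < α) {u : ℝ} (hu : 0 ≤ u) : u ≤ zygmund α u :=
  le_mul_of_one_le_right hu (Real.one_le_rpow (one_le_log_exp_one_add hu) hα.le)

theorem zygmund_mono (hα : 0 < α) {u v : ℝ} (hu : 0 ≤ u) (huv : u ≤ v) :
    zygmund α u ≤ zygmund α v := by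
  have h := one_le_log_exp_one_add hu
  have h2 := Real.exp_pos 1
  have h3 : Real.log (Real.exp 1 + u) ≤ Real.log (Real.exp 1 + v) :=
    Real.log_le_log (by positivity) (by linarith)
  have h4 := Real.rpow_le_rpow (by linarith) h3 hα.le
  have h5 : 0 ≤ Real.log (Real.exp 1 + u) ^ α := Real.rpow_nonneg (by linarith) _
  exact mul_le_mul huv h4 h5 (hu.trans huv)

theorem zygmund_div_le (hα : 0 < α) {u M : ℝ} (hu : 0 ≤ u) (hM : 1 ≤ M) :
    zygmund α (u / M) ≤ zygmund α u / M := by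
  have h0 : 0 ≤ u / M := by positivity
  have h := one_le_log_exp_one_add h0
  have h2 := Real.exp_pos 1
  have h3 : Real.log (Real.exp 1 + u / M) ≤ Real.log (Real.exp 1 + u) :=
    Real.log_le_log (by positivity) (by linarith [div_le_self hu hM])
  have h4 := Real.rpow_le_rpow (by linarith) h3 hα.le
  unfold zygmund
  rw [mul_div_right_comm]
  exact mul_le_mul_of_nonneg_left h4 h0

theorem exp_one_add_two_le : Real.exp 1 + 2 ≤ Real.exp 2 := by
  have h := Real.add_one_le_exp (1 : ℝ)
  rw [show (2 : ℝ) = 1 + 1 by norm_num, Real.exp_add]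
  nlinarith

/-- One term suffices: for the largest `n` with `e^{λ_n} ≤ u/2`, the excess is at least `u/2` and
`log(e+u) ≤ 4·2^n`. Values `u < 2` are absorbed by the constant. -/
theorem zygmund_le_tsum (hα : 0 < α) {u : ℝ} (hu : 0 ≤ u) :
    ENNReal.ofReal (zygmund α u) ≤ ENNReal.ofReal (2 * 4 ^ α) *
      (1 + ∑' n, dyadicWeight α n * ENNReal.ofReal (u - Real.exp (dyadicLevel n))) := by
  rcases lt_or_ge u 2 with h | h
  · have h1 : zygmund α u ≤ 2 * 4 ^ α := by
      have e2 := exp_one_add_two_le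
      have h0 : Real.log (Real.exp 1 + u) ≤ 4 := by
        rw [Real.log_le_iff_le_exp (by positivity)]
        have := Real.exp_le_exp.2 (show (2 : ℝ) ≤ 4 by norm_num)
        linarith
      have h3 := one_le_log_exp_one_add hu
      have h2 := Real.rpow_le_rpow (by linarith) h0 hα.le
      exact mul_le_mul h.le h2 (Real.rpow_nonneg (by linarith) _) zero_le_two
    exact (ENNReal.ofReal_le_ofReal h1).trans (le_mul_of_one_le_right' (by simp))
  · set n := Nat.log 2 ⌊1 + Real.log (u / 2)⌋₊ with hn
    have hu2 : 1 ≤ u / 2 := by linarith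
    have hl := Real.log_nonneg hu2
    have h1 : (2 : ℝ) ^ n ≤ 1 + Real.log (u / 2) := two_pow_log_floor_le (by linarith)
    have h2 : 1 + Real.log (u / 2) < 2 ^ (n + 1) := lt_two_pow_log_floor_succ _
    have h3 : Real.exp (dyadicLevel n) ≤ u / 2 := by
      rw [← Real.le_log_iff_exp_le (by linarith), dyadicLevel]; linarith
    have h4 : Real.log (Real.exp 1 + u) ≤ 4 * 2 ^ n := by
      have e1 : Real.exp 1 + u ≤ Real.exp 2 * (u / 2) := by
        have := exp_one_add_two_le
        have := Real.exp_pos 1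
        nlinarith
      have e2 := Real.log_le_log (by positivity) e1
      rw [Real.log_mul (by positivity) (by linarith), Real.log_exp] at e2
      rw [pow_succ] at h2
      linarith
    have h5 : zygmund α u ≤ 2 * 4 ^ α * (((2 : ℝ) ^ n) ^ α * (u - Real.exp (dyadicLevel n))) := by
      have h3' := one_le_log_exp_one_add hu
      have h6 := Real.rpow_le_rpow (by linarith) h4 hα.le
      rw [Real.mul_rpow (by norm_num) (by positivity)] at h6
      have h7 : 0 ≤ (4 : ℝ) ^ α * ((2 : ℝ) ^ n) ^ α := by positivity
      calc zygmund α u ≤ u * (4 ^ α * ((2 : ℝ) ^ n) ^ α) := mul_le_mul_of_nonneg_left h6 hu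
        _ ≤ (2 * (u - Real.exp (dyadicLevel n))) * (4 ^ α * ((2 : ℝ) ^ n) ^ α) := by
            gcongr; linarith
        _ = _ := by ring
    refine (ENNReal.ofReal_le_ofReal h5).trans ?_
    rw [ENNReal.ofReal_mul (by positivity)]
    gcongr
    refine le_trans ?_ le_add_self
    rw [ENNReal.ofReal_mul (by positivity)]
    exact ENNReal.le_tsum (f := fun n => dyadicWeight α n *
      ENNReal.ofReal (u - Real.exp (dyadicLevel n))) n

/-- A Young-type inequality. If `u ≥ √y`, then `log y` is at most `2 log(e+u)`; otherwise the left
side is at most `√y` times a logarithm, hence of order `y^{3/4}`. With `y = 1/s` this power is still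
integrable on `(0,1)`. -/
theorem mul_one_add_log_rpow_le (hα : 0 < α) {u y : ℝ} (hu : 0 ≤ u) (hy : 1 ≤ y) :
    u * (1 + Real.log y) ^ α ≤ 4 ^ α * zygmund α u + (α + 1) ^ α * 4 ^ α * y ^ (3 / 4 : ℝ) := by
  have hy0 : 0 < y := by linarith
  have hl := Real.log_nonneg hy
  have hz := zygmund_nonneg (α := α) hu
  rcases le_or_gt (y ^ (1 / 2 : ℝ)) u with h | h
  · have h1 : Real.log y ≤ 2 * Real.log (Real.exp 1 + u) := by
      have := Real.log_le_log (by positivity) (h.trans (le_add_of_nonneg_left (Real.exp_pos 1).le))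
      rw [Real.log_rpow hy0] at this
      linarith
    have h2 := one_le_log_exp_one_add hu
    have h3 := Real.rpow_le_rpow (by linarith) (show 1 + Real.log y ≤
      4 * Real.log (Real.exp 1 + u) by linarith) hα.le
    rw [Real.mul_rpow (by norm_num) (by linarith)] at h3
    have h4 : u * (1 + Real.log y) ^ α ≤ 4 ^ α * zygmund α u := by
      refine (mul_le_mul_of_nonneg_left h3 hu).trans (le_of_eq ?_)
      rw [zygmund]; ring
    have : 0 ≤ (α + 1) ^ α * 4 ^ α * y ^ (3 / 4 : ℝ) := by positivity
    linarith
  · have h1 := one_add_log_rpow_le hα (θ := 1 / 4) (by norm_num) (by norm_num) hy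
    have e : ((1 : ℝ) / 4) ^ (-α) = 4 ^ α := by
      rw [Real.rpow_neg (by norm_num), one_div, Real.inv_rpow (by norm_num), inv_inv]
    rw [e] at h1
    calc u * (1 + Real.log y) ^ α
        ≤ y ^ (1 / 2 : ℝ) * ((α + 1) ^ α * 4 ^ α * y ^ (1 / 4 : ℝ)) :=
          mul_le_mul h.le h1 (by positivity) (by positivity)
      _ = (α + 1) ^ α * 4 ^ α * y ^ (3 / 4 : ℝ) := by
          rw [show (3 / 4 : ℝ) = 1 / 2 + 1 / 4 by norm_num, Real.rpow_add hy0]; ring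
      _ ≤ _ := le_add_of_nonneg_left (by positivity)

/-- Since `θ^{-α} ≥ 1`, only levels with `e^{λ_n} < u/V` contribute. Their weights add up to a
multiple of `(1 + log(u/V))^α`, hence of `θ^{-α} (u/V)^θ`, and `1 + θ ≤ 1/(1-θ)`. -/
theorem tsum_dyadicWeight_mul_sub_le (hα : 0 < α) {θ u V : ℝ} (hθ : θ ∈ Ioo (0 : ℝ) 1)
    (hu : 0 ≤ u) (hV : 0 < V) :
    ∑' n, dyadicWeight α n * ENNReal.ofReal (u - θ ^ (-α) * V * Real.exp (dyadicLevel n)) ≤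
      ENNReal.ofReal (dyadicConst α * (α + 1) ^ α * (θ ^ (-α) * V) * (u / V) ^ (1 / (1 - θ))) := by
  have hD := dyadicConst_pos hα
  have hθ0 := hθ.1
  have hθα : 1 ≤ θ ^ (-α) :=
    Real.one_le_rpow_of_pos_of_le_one_of_nonpos hθ.1 hθ.2.le (by linarith)
  have h0 : ∀ n, u ≤ V * Real.exp (dyadicLevel n) →
      ENNReal.ofReal (u - θ ^ (-α) * V * Real.exp (dyadicLevel n)) = 0 := fun n hn => by
    refine ENNReal.ofReal_of_nonpos (sub_nonpos.2 (hn.trans ?_))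
    rw [mul_assoc]
    exact le_mul_of_one_le_left (by positivity) hθα
  rcases le_or_gt u V with h | h
  · have : ∀ n, u ≤ V * Real.exp (dyadicLevel n) := fun n =>
      h.trans (le_mul_of_one_le_right hV.le (Real.one_le_exp (dyadicLevel_nonneg n)))
    simp [h0 _ (this _)]
  · have hv : 1 < u / V := by rwa [one_lt_div hV]
    have hv0 : 0 < u / V := by linarith
    calc _ ≤ ∑' n, ENNReal.ofReal u *
          (if dyadicLevel n < Real.log (u / V) then dyadicWeight α n else 0) := by
          refine ENNReal.tsum_le_tsum fun n => ?_
          split_ifs with hn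
          · rw [mul_comm]
            gcongr
            exact sub_le_self _ (by positivity)
          · rw [not_lt, Real.log_le_iff_le_exp hv0, div_le_iff₀' hV] at hn
            simp [h0 n hn]
      _ ≤ ENNReal.ofReal u * ENNReal.ofReal (dyadicConst α * (1 + Real.log (u / V)) ^ α) := by
          rw [ENNReal.tsum_mul_left]
          gcongr
          exact tsum_dyadicWeight_le hα (Real.log_nonneg hv.le)
      _ ≤ _ := by
          rw [← ENNReal.ofReal_mul hu]
          refine ENNReal.ofReal_le_ofReal ?_
          have h1 := one_add_log_rpow_le hα hθ0 hθ.2.le hv.le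
          have h2 : u / V * (u / V) ^ θ ≤ (u / V) ^ (1 / (1 - θ)) := by
            rw [mul_comm, ← Real.rpow_add_one hv0.ne']
            refine Real.rpow_le_rpow_of_exponent_le hv.le ?_
            rw [le_div_iff₀ (by linarith [hθ.2])]
            nlinarith
          calc u * (dyadicConst α * (1 + Real.log (u / V)) ^ α)
              ≤ u * (dyadicConst α * ((α + 1) ^ α * θ ^ (-α) * (u / V) ^ θ)) := by gcongr
            _ = dyadicConst α * (α + 1) ^ α * (θ ^ (-α) * V) * (u / V * (u / V) ^ θ) := by
                field_simp
            _ ≤ _ := by gcongr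

theorem zygmund_le_posLog (hα : 0 < α) {u : ℝ} (hu : 0 ≤ u) :
    zygmund α u ≤ 3 * 2 ^ α * (1 + u * Real.posLog u ^ α) := by
  have he := Real.exp_one_lt_d9
  have h2 := one_le_log_exp_one_add hu
  have hp : 0 ≤ u * Real.posLog u ^ α := mul_nonneg hu (Real.rpow_nonneg Real.posLog_nonneg _)
  have h2α : (0 : ℝ) < 2 ^ α := by positivity
  have e2 : Real.exp 1 * Real.exp 1 = Real.exp 2 := by rw [← Real.exp_add]; norm_num
  have e1 := Real.add_one_le_exp (1 : ℝ)
  rcases le_or_gt u (Real.exp 1) with h | h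
  · have h3 : Real.log (Real.exp 1 + u) ≤ 2 := by
      rw [Real.log_le_iff_le_exp (by positivity)]
      nlinarith
    have h4 := Real.rpow_le_rpow (by linarith) h3 hα.le
    have h5 : zygmund α u ≤ 3 * 2 ^ α :=
      mul_le_mul (by linarith) h4 (Real.rpow_nonneg (by linarith) _) (by norm_num)
    nlinarith
  · have hu0 : 0 < u := (Real.exp_pos 1).trans h
    have hlog : 1 ≤ Real.log u := by rw [Real.le_log_iff_exp_le hu0]; exact h.le
    have h3 : Real.log (Real.exp 1 + u) ≤ 2 * Real.posLog u := by
      rw [Real.posLog_eq_log (by rw [abs_of_pos hu0]; linarith)]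
      have h6 : Real.exp 1 + u ≤ Real.exp 1 * u := by nlinarith
      have h7 := Real.log_le_log (by positivity) h6
      rw [Real.log_mul (Real.exp_pos 1).ne' hu0.ne', Real.log_exp] at h7
      linarith
    have h4 := Real.rpow_le_rpow (by linarith) h3 hα.le
    rw [Real.mul_rpow zero_le_two Real.posLog_nonneg] at h4
    have h5 : zygmund α u ≤ u * (2 ^ α * Real.posLog u ^ α) := mul_le_mul_of_nonneg_left h4 hu
    nlinarith

/-- From `log u = log c + log(u/c)`: rescaling changes the Zygmund integrand by a constant factor
only, so finiteness for one `c` gives finiteness at scale one. -/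
theorem mul_posLog_rpow_le (hα : 0 < α) {u c : ℝ} (hu : 0 ≤ u) (hc : 1 ≤ c) :
    u * Real.posLog u ^ α ≤ c * (1 + Real.log c) ^ α * zygmund α (u / c) := by
  have hc0 : 0 < c := by linarith
  have hv : 0 ≤ u / c := by positivity
  have hl := Real.log_nonneg hc
  have h2 := one_le_log_exp_one_add hv
  have h3 : Real.posLog u ≤ (1 + Real.log c) * Real.log (Real.exp 1 + u / c) := by
    have h4 : 0 ≤ (1 + Real.log c) * Real.log (Real.exp 1 + u / c) :=
      mul_nonneg (by linarith) (by linarith)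
    rw [Real.posLog_def]
    refine max_le h4 ?_
    rcases hu.eq_or_lt with rfl | hu0
    · simpa using h4
    have h5 : Real.log u = Real.log c + Real.log (u / c) := by
      rw [Real.log_div hu0.ne' hc0.ne']; ring
    have h6 : Real.log (u / c) ≤ Real.log (Real.exp 1 + u / c) :=
      Real.log_le_log (by positivity) (le_add_of_nonneg_left (Real.exp_pos 1).le)
    nlinarith
  have h4 := Real.rpow_le_rpow Real.posLog_nonneg h3 hα.le
  rw [Real.mul_rpow (by linarith) (by linarith)] at h4
  calc u * Real.posLog u ^ α
      ≤ u * ((1 + Real.log c) ^ α * Real.log (Real.exp 1 + u / c) ^ α) :=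
        mul_le_mul_of_nonneg_left h4 hu
    _ = _ := by rw [zygmund]; field_simp

/-- The parameters `2 ^ (-(n + 1))` carrying the terms of the decomposition. -/
def dyadicTheta (n : ℕ) : ℝ := ((2 : ℝ) ^ (n + 1))⁻¹

theorem dyadicTheta_mem (n : ℕ) : dyadicTheta n ∈ Ioo (0 : ℝ) 1 :=
  ⟨by unfold dyadicTheta; positivity,
    inv_lt_one_of_one_lt₀ (one_lt_pow₀ one_lt_two n.succ_ne_zero)⟩

theorem dyadicTheta_injective : Function.Injective dyadicTheta := fun m n h => by
  have := pow_right_injective₀ (zero_lt_two (α := ℝ)) (by norm_num) (inv_injective h)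
  omega

theorem dyadicTheta_rpow (α : ℝ) (n : ℕ) :
    ENNReal.ofReal (dyadicTheta n ^ (-α)) = ENNReal.ofReal (2 ^ α) * dyadicWeight α n := by
  rw [dyadicWeight, ← ENNReal.ofReal_mul (by positivity), dyadicTheta,
    Real.inv_rpow (by positivity), Real.rpow_neg (by positivity), inv_inv, pow_succ,
    Real.mul_rpow (by positivity) (by positivity), mul_comm]

theorem rpow_one_sub_le {e δ : ℝ≥0∞} {θ : ℝ} (hθ : θ ∈ Ioo (0 : ℝ) 1) (hδ : δ ≠ 0)
    (hδ' : δ ≠ ∞) : e ^ (1 - θ) ≤ (e + δ) * δ ^ (-θ) := by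
  rcases eq_or_ne e ∞ with rfl | he
  · rw [top_add, ENNReal.top_mul]
    · exact le_top
    · simp [ENNReal.rpow_eq_zero_iff, hδ, hδ']
  calc e ^ (1 - θ) ≤ (e + δ) ^ (1 - θ) :=
        ENNReal.rpow_le_rpow le_self_add (by linarith [hθ.2])
    _ = (e + δ) * (e + δ) ^ (-θ) := by
        rw [sub_eq_add_neg, ENNReal.rpow_add _ _ (by simp [hδ]) (by simp [he, hδ']),
          ENNReal.rpow_one]
    _ ≤ (e + δ) * δ ^ (-θ) := by
        rw [ENNReal.rpow_neg, ENNReal.rpow_neg]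
        gcongr
        · exact hθ.1.le
        · exact le_add_self

/-- The exponent `1 - θ_n` comes from the `L^p` norm. Replacing it by `1` is harmless once `e n` is
not too small, and the small values are covered by a summable error. -/
theorem tsum_dyadicWeight_mul_rpow_le (hα : 0 < α) (e : ℕ → ℝ≥0∞) :
    ∑' n, dyadicWeight α n * e n ^ (1 - dyadicTheta n) ≤
      ENNReal.ofReal (2 ^ (α + 1)) * (∑' n, dyadicWeight α n * e n + 2) := by
  -- The size of `δ n` serves two ends: the weight times `δ n` is `2^{-n}`, which sums to `2`, and
  -- `n θ_n ≤ 1` keeps `δ n ^ (-θ_n)` below `2^(α+1)`.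
  set δ : ℕ → ℝ≥0∞ := fun n => ENNReal.ofReal (((2 : ℝ) ^ n) ^ (-(α + 1))) with hδ
  have h1 : ∀ n, dyadicWeight α n * e n ^ (1 - dyadicTheta n) ≤
      ENNReal.ofReal (2 ^ (α + 1)) * (dyadicWeight α n * e n + (2⁻¹ : ℝ≥0∞) ^ n) := fun n => by
    have hδ0 : δ n ≠ 0 := by
      simp only [hδ, ne_eq, ENNReal.ofReal_eq_zero, not_le]; positivity
    have h2 : δ n ^ (-dyadicTheta n) ≤ ENNReal.ofReal (2 ^ (α + 1)) := by
      rw [hδ, ENNReal.ofReal_rpow_of_pos (by positivity)]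
      refine ENNReal.ofReal_le_ofReal ?_
      rw [← Real.rpow_mul (by positivity), ← Real.rpow_natCast, ← Real.rpow_mul zero_le_two]
      refine Real.rpow_le_rpow_of_exponent_le one_le_two ?_
      have h3 : (n : ℝ) * dyadicTheta n ≤ 1 := by
        rw [dyadicTheta, ← div_eq_mul_inv, div_le_one (by positivity)]
        have : n ≤ 2 ^ (n + 1) := (Nat.lt_two_pow_self.le).trans
          (Nat.pow_le_pow_right two_pos n.le_succ)
        exact_mod_cast this
      nlinarith
    have h4 : dyadicWeight α n * δ n = (2⁻¹ : ℝ≥0∞) ^ n := by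
      rw [hδ, dyadicWeight, ← ENNReal.ofReal_mul (by positivity), ← Real.rpow_add (by positivity),
        show α + -(α + 1) = -1 by ring, Real.rpow_neg_one, ENNReal.ofReal_inv_of_pos (by positivity),
        ENNReal.ofReal_pow zero_le_two, ENNReal.inv_pow, ENNReal.ofReal_ofNat]
    calc _ ≤ dyadicWeight α n * ((e n + δ n) * δ n ^ (-dyadicTheta n)) := by
          gcongr; exact rpow_one_sub_le (dyadicTheta_mem n) hδ0 ENNReal.ofReal_ne_top
      _ ≤ dyadicWeight α n * ((e n + δ n) * ENNReal.ofReal (2 ^ (α + 1))) := by gcongr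
      _ = ENNReal.ofReal (2 ^ (α + 1)) * (dyadicWeight α n * e n + dyadicWeight α n * δ n) := by ring
      _ = _ := by rw [h4]
  refine (ENNReal.tsum_le_tsum h1).trans (le_of_eq ?_)
  rw [ENNReal.tsum_mul_left, ENNReal.tsum_add, ENNReal.tsum_geometric, ENNReal.one_sub_inv_two,
    inv_inv]

end Scalar

/-! ### Subadditivity of the excess of `k` over a level. -/

section Submajorization

variable {𝕜 A₀ A₁ : Type*} [RCLike 𝕜]
  [NormedAddCommGroup A₀] [NormedSpace 𝕜 A₀] [NormedAddCommGroup A₁] [NormedSpace 𝕜 A₁]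
  {ι : A₁ →L[𝕜] A₀}

/-- The superlevel sets of `k(·, x)` in `(0, 1)` are initial intervals. -/
theorem exists_kDensity_threshold (ι : A₁ →L[𝕜] A₀) (x : A₀) (r : ℝ) :
    ∃ τ ∈ Icc (0 : ℝ) 1, (∀ s ∈ Ioo 0 τ, r < kDensity ι s x) ∧
      ∀ s ∈ Ioo (0 : ℝ) 1, τ < s → kDensity ι s x ≤ r := by
  set J := {s ∈ Ioo (0 : ℝ) 1 | r < kDensity ι s x} with hJ
  have hb : BddAbove J := ⟨1, fun s hs => hs.1.2.le⟩
  refine ⟨sSup J, ⟨Real.sSup_nonneg fun s hs => hs.1.1.le, Real.sSup_le (fun s hs => hs.1.2.le)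
    zero_le_one⟩, fun s hs => ?_, fun s hs hτ => ?_⟩
  · have hne : J.Nonempty := by
      by_contra h
      rw [not_nonempty_iff_eq_empty] at h
      rw [h, Real.sSup_empty] at hs
      exact lt_asymm hs.1 hs.2
    obtain ⟨j, hj, hsj⟩ := exists_lt_of_lt_csSup hne hs.2
    exact hj.2.trans_le (antitoneOn_kDensity ι x hs.1 hj.1.1 hsj.le)
  · by_contra! h
    exact absurd (le_csSup hb (show s ∈ J from ⟨hs, h⟩)) (not_le.2 hτ)

/-- If `τ` ends the interval where `k(·,x) > S r`, the left side is `K(τ,x) - S r τ`. For each `i`,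
at this same `τ`, `K(τ,u i) - c i r τ` is at most the excess integral of `u i`, and the subtracted
terms total at most `S r τ`. -/
theorem lintegral_kDensity_sub_le {T : Type*} (hι : IsOrderedPair ι) (x : A₀) (u : T → A₀)
    (hK : ∀ t, 0 ≤ t → ENNReal.ofReal (kFunctional ι t x) ≤
      ∑' i, ENNReal.ofReal (kFunctional ι t (u i)))
    (c : T → ℝ) {S r : ℝ} (hc : ∀ i, 0 ≤ c i) (hS : 0 ≤ S) (hr : 0 ≤ r)
    (hcS : ∑' i, ENNReal.ofReal (c i) ≤ ENNReal.ofReal S) :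
    ∫⁻ s in Ioo 0 1, ENNReal.ofReal (kDensity ι s x - S * r) ≤
      ∑' i, ∫⁻ s in Ioo 0 1, ENNReal.ofReal (kDensity ι s (u i) - c i * r) := by
  obtain ⟨τ, hτ, h1, h2⟩ := exists_kDensity_threshold ι x (S * r)
  have hτ1 : τ ≤ 1 := hτ.2
  have hvol : volume (Ioo 0 τ) = ENNReal.ofReal τ := by rw [Real.volume_Ioo, sub_zero]
  have hA : ∫⁻ s in Ioo 0 1, ENNReal.ofReal (kDensity ι s x - S * r) ≤
      ∫⁻ s in Ioo 0 τ, ENNReal.ofReal (kDensity ι s x - S * r) := by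
    rw [setLIntegral_congr (Ioo_ae_eq_Ioc (a := (0 : ℝ)) (b := τ)),
      ← lintegral_indicator measurableSet_Ioo, ← lintegral_indicator measurableSet_Ioc]
    refine lintegral_mono fun s => ?_
    by_cases hs : s ∈ Ioo (0 : ℝ) 1
    · rw [indicator_of_mem hs]
      by_cases hsτ : s ≤ τ
      · rw [indicator_of_mem (show s ∈ Ioc 0 τ from ⟨hs.1, hsτ⟩)]
      · rw [ENNReal.ofReal_of_nonpos (sub_nonpos.2 (h2 s hs (not_le.1 hsτ)))]
        exact zero_le
    · rw [indicator_of_notMem hs]; exact zero_le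
  have hfin : ENNReal.ofReal (S * r) * ENNReal.ofReal τ ≠ ∞ :=
    ENNReal.mul_ne_top ENNReal.ofReal_ne_top ENNReal.ofReal_ne_top
  -- Subtraction in `ℝ≥0∞` is avoided by adding the finite quantity `S r τ` to both sides.
  refine hA.trans ((ENNReal.add_le_add_iff_right hfin).1 ?_)
  calc (∫⁻ s in Ioo 0 τ, ENNReal.ofReal (kDensity ι s x - S * r)) +
        ENNReal.ofReal (S * r) * ENNReal.ofReal τ
      = ∫⁻ s in Ioo 0 τ, (ENNReal.ofReal (kDensity ι s x - S * r) + ENNReal.ofReal (S * r)) := by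
        rw [lintegral_add_right _ measurable_const, setLIntegral_const, hvol]
    _ = ∫⁻ s in Ioo 0 τ, ENNReal.ofReal (kDensity ι s x) := by
        refine setLIntegral_congr_fun measurableSet_Ioo fun s hs => ?_
        rw [← ENNReal.ofReal_add (sub_nonneg.2 (h1 s hs).le) (by positivity), sub_add_cancel]
    _ = ENNReal.ofReal (kFunctional ι τ x) := lintegral_kDensity hι hτ.1 x
    _ ≤ ∑' i, ENNReal.ofReal (kFunctional ι τ (u i)) := hK τ hτ.1
    _ ≤ ∑' i, ((∫⁻ s in Ioo 0 1, ENNReal.ofReal (kDensity ι s (u i) - c i * r)) +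
          ENNReal.ofReal (c i) * (ENNReal.ofReal r * ENNReal.ofReal τ)) := by
        refine ENNReal.tsum_le_tsum fun i => ?_
        rw [← lintegral_kDensity hι hτ.1]
        calc _ ≤ ∫⁻ s in Ioo 0 τ,
              (ENNReal.ofReal (kDensity ι s (u i) - c i * r) + ENNReal.ofReal (c i * r)) := by
              refine lintegral_mono fun s => ?_
              refine le_trans (ENNReal.ofReal_le_ofReal (le_of_eq ?_)) ENNReal.ofReal_add_le
              ring
          _ = (∫⁻ s in Ioo 0 τ, ENNReal.ofReal (kDensity ι s (u i) - c i * r)) +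
              ENNReal.ofReal (c i * r) * ENNReal.ofReal τ := by
              rw [lintegral_add_right _ measurable_const, setLIntegral_const, hvol]
          _ ≤ _ := by
              rw [ENNReal.ofReal_mul (hc i), mul_assoc]
              gcongr
    _ = (∑' i, ∫⁻ s in Ioo 0 1, ENNReal.ofReal (kDensity ι s (u i) - c i * r)) +
          (∑' i, ENNReal.ofReal (c i)) * (ENNReal.ofReal r * ENNReal.ofReal τ) := by
        rw [ENNReal.tsum_add, ENNReal.tsum_mul_right]
    _ ≤ _ := by
        rw [ENNReal.ofReal_mul hS, mul_assoc]
        gcongr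

variable {Ω : Type*} [MeasurableSpace Ω]

theorem ae_kFunctional_le_tsum {T : Type*} [Countable T] (ι : A₁ →L[𝕜] A₀) {μ : Measure Ω}
    {g : T → Lp A₀ 1 μ} {f : Lp A₀ 1 μ} (h : HasSum g f) :
    ∀ᵐ w ∂μ, ∀ t, 0 ≤ t → ENNReal.ofReal (kFunctional ι t (f w)) ≤
      ∑' i, ENNReal.ofReal (kFunctional ι t (g i w)) := by
  -- Unconditional convergence in `L¹` gives finite partial sums converging almost everywhere. The
  -- exceptional set does not depend on `t`, because `K(t,·)` is continuous for each `t`.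
  obtain ⟨F, -, hF⟩ := (tendstoInMeasure_of_tendsto_Lp (p := 1) h).exists_seq_tendsto_ae'
  filter_upwards [hF, ae_all_iff.2 fun n => Lp.coeFn_finsetSum (F n) g] with w h1 h2 t ht
  simp only [h2, Finset.sum_apply] at h1
  have h3 := ((lipschitzWith_kFunctional ι ht).continuous.tendsto (f w)).comp h1
  refine le_of_tendsto ((ENNReal.continuous_ofReal.tendsto _).comp h3) (.of_forall fun n => ?_)
  calc ENNReal.ofReal (kFunctional ι t (∑ i ∈ F n, g i w))
      ≤ ENNReal.ofReal (∑ i ∈ F n, kFunctional ι t (g i w)) :=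
        ENNReal.ofReal_le_ofReal (kFunctional_sum_le ι ht _ _)
    _ = ∑ i ∈ F n, ENNReal.ofReal (kFunctional ι t (g i w)) :=
        ENNReal.ofReal_sum_of_nonneg fun i _ => kFunctional_nonneg ι ht _
    _ ≤ _ := ENNReal.sum_le_tsum _

end Submajorization

/-- Both norms are infima that need not be attained, so each comparison is made with a real `S`
slightly above. This also covers `N = 0` and, since `C ≠ 0`, `N = ∞`. -/
theorem ENNReal_le_mul_of_forall_lt_ofReal {L N C : ℝ≥0∞} (hC : C ≠ 0) (hC' : C ≠ ∞)
    (h : ∀ S : ℝ, 0 < S → N < ENNReal.ofReal S → L ≤ C * ENNReal.ofReal S) : L ≤ C * N := by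
  refine (ENNReal.div_le_iff' hC hC').1 ?_
  refine le_of_forall_gt_imp_ge_of_dense fun a ha => ?_
  rcases eq_or_ne a ∞ with rfl | ha'
  · exact le_top
  have ha0 : 0 < a.toReal := ENNReal.toReal_pos (ne_bot_of_gt ha) ha'
  have h' := h a.toReal ha0 (by rwa [ENNReal.ofReal_toReal ha'])
  rw [ENNReal.ofReal_toReal ha'] at h'
  exact ENNReal.div_le_of_le_mul' h'

/-- For `M ≥ 1` the Young function at `u/M` is at most its value at `u` divided by `M`, so enlarging
`c` to `c M` brings the integral below one. -/
theorem lLogLNorm_le_of_lintegral_le {Θ : Type*} [MeasurableSpace Θ] {α : ℝ} (hα : 0 < α)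
    {ν : Measure Θ} {g : Θ → ℝ} {c M : ℝ} (hc : 0 < c) (hM : 1 ≤ M)
    (h : ∫⁻ z, ENNReal.ofReal (zygmund α (|g z| / c)) ∂ν ≤ ENNReal.ofReal M) :
    lLogLNorm α ν g ≤ ENNReal.ofReal (c * M) := by
  have hM0 : 0 < M := by linarith
  refine iInf₂_le (c * M) ⟨by positivity, ?_⟩
  calc _ ≤ ∫⁻ z, ENNReal.ofReal (zygmund α (|g z| / c)) * (ENNReal.ofReal M)⁻¹ ∂ν := by
        refine lintegral_mono fun z => ?_
        rw [← div_div, ← div_eq_mul_inv, ← ENNReal.ofReal_div_of_pos hM0]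
        exact ENNReal.ofReal_le_ofReal (zygmund_div_le hα (by positivity) hM)
    _ = (∫⁻ z, ENNReal.ofReal (zygmund α (|g z| / c)) ∂ν) * (ENNReal.ofReal M)⁻¹ :=
        lintegral_mul_const' _ _ (by simpa using hM0)
    _ ≤ ENNReal.ofReal M * (ENNReal.ofReal M)⁻¹ := by gcongr
    _ ≤ 1 := ENNReal.mul_inv_le_one _

/-! ### The Zygmund norm is bounded by the sum norm. -/

section UpperEstimate

variable {𝕜 A₀ A₁ Ω : Type*} [RCLike 𝕜]
  [NormedAddCommGroup A₀] [NormedSpace 𝕜 A₀] [NormedAddCommGroup A₁] [NormedSpace 𝕜 A₁]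
  {ι : A₁ →L[𝕜] A₀} [MeasurableSpace Ω] {μ : Measure Ω} {α : ℝ}

/-- The product of `μ` and Lebesgue measure on `(0, 1)`. -/
abbrev prodUnit (μ : Measure Ω) : Measure (Ω × ℝ) := μ.prod (volume.restrict (Ioo (0 : ℝ) 1))

theorem ae_snd_mem (μ : Measure Ω) : ∀ᵐ z ∂(prodUnit μ), z.2 ∈ Ioo (0 : ℝ) 1 :=
  Measure.quasiMeasurePreserving_snd.ae (ae_restrict_mem measurableSet_Ioo)

theorem ae_Psi_nonneg (ι : A₁ →L[𝕜] A₀) (μ : Measure Ω) (f : Ω → A₀) :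
    ∀ᵐ z ∂(prodUnit μ), 0 ≤ Psi ι f z := by
  filter_upwards [ae_snd_mem μ] with z hz using kDensity_nonneg ι hz.1 _

theorem aestronglyMeasurable_Psi_Lp [SFinite μ] (hι : IsOrderedPair ι) (f : Lp A₀ 1 μ) :
    AEStronglyMeasurable (Psi ι f) (prodUnit μ) :=
  aestronglyMeasurable_Psi hι (Lp.stronglyMeasurable f) μ

theorem aemeasurable_Psi_Lp [SFinite μ] (hι : IsOrderedPair ι) (f : Lp A₀ 1 μ) :
    AEMeasurable (Psi ι f) (prodUnit μ) :=
  (aestronglyMeasurable_Psi_Lp hι f).aemeasurable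

theorem lintegral_Psi [SFinite μ] (hι : IsOrderedPair ι) (f : Lp A₀ 1 μ) :
    ∫⁻ z, ENNReal.ofReal (Psi ι f z) ∂(prodUnit μ) = ∫⁻ w, ‖f w‖ₑ ∂μ := by
  rw [lintegral_prod _ (aemeasurable_Psi_Lp hι f).ennreal_ofReal]
  refine lintegral_congr fun w => ?_
  simp only [Psi]
  rw [lintegral_kDensity hι zero_le_one, kFunctional_eq_norm hι le_rfl, ofReal_norm]

theorem lintegral_Psi_rpow_le (hι : IsOrderedPair ι) {θ : ℝ} (hθ : θ ∈ Ioo (0 : ℝ) 1)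
    (f : Ω → A₀) : ∫⁻ z, ENNReal.ofReal (Psi ι f z ^ pExp θ) ∂(prodUnit μ) ≤
      ∫⁻ w, averagePow ι θ (f w) ∂μ :=
  (lintegral_prod_le _).trans (lintegral_mono fun w => lintegral_kDensity_rpow_le hι hθ (f w))

/-- By the reverse Hardy inequality `Ψ_g` vanishes almost everywhere, and its integral is the `L¹`
norm of `g`. This permits discarding every index of zero norm from a representation. -/
theorem eq_zero_of_vectorLpNorm_eq_zero [SFinite μ] (hι : IsOrderedPair ι) {θ : ℝ}
    (hθ : θ ∈ Ioo (0 : ℝ) 1) {g : Lp A₀ 1 μ} (h : vectorLpNorm ι θ (pExp θ) (pExp θ) μ g = 0) :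
    g = 0 := by
  have hp := one_lt_pExp hθ
  rw [vectorLpNorm_eq ι hθ, ENNReal.rpow_eq_zero_iff_of_pos (by positivity)] at h
  have h1 := (lintegral_Psi_rpow_le (μ := μ) hι hθ g).trans h.le
  rw [nonpos_iff_eq_zero, lintegral_eq_zero_iff'
    ((aemeasurable_Psi_Lp hι g).pow_const _).ennreal_ofReal] at h1
  have h2 : ∫⁻ z, ENNReal.ofReal (Psi ι g z) ∂(prodUnit μ) = 0 := by
    rw [lintegral_eq_zero_iff' (aemeasurable_Psi_Lp hι g).ennreal_ofReal]
    filter_upwards [h1, ae_Psi_nonneg ι μ g] with z hz hz0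
    rw [Pi.zero_apply, ENNReal.ofReal_eq_zero] at hz ⊢
    exact ((Real.rpow_eq_zero hz0 (by positivity)).1
      (le_antisymm hz (Real.rpow_nonneg hz0 _))).le
  rw [lintegral_Psi hι, lintegral_eq_zero_iff' (Lp.aestronglyMeasurable g).enorm] at h2
  rw [Lp.eq_zero_iff_ae_eq_zero]
  filter_upwards [h2] with w hw
  simpa using hw

theorem lintegral_Psi_sub_le [SFinite μ] {T : Type*} [Countable T] (hι : IsOrderedPair ι)
    {g : T → Lp A₀ 1 μ} {f : Lp A₀ 1 μ} (h : HasSum g f) (c : T → ℝ) {S r : ℝ}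
    (hc : ∀ i, 0 ≤ c i) (hS : 0 ≤ S) (hr : 0 ≤ r)
    (hcS : ∑' i, ENNReal.ofReal (c i) ≤ ENNReal.ofReal S) :
    ∫⁻ z, ENNReal.ofReal (Psi ι f z - S * r) ∂(prodUnit μ) ≤
      ∑' i, ∫⁻ z, ENNReal.ofReal (Psi ι (g i) z - c i * r) ∂(prodUnit μ) := by
  have hm : ∀ (u : Lp A₀ 1 μ) (a : ℝ), AEMeasurable
      (fun z => ENNReal.ofReal (Psi ι u z - a)) (prodUnit μ) := fun u a =>
    ((aemeasurable_Psi_Lp hι u).sub_const a).ennreal_ofReal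
  rw [lintegral_prod _ (hm f _)]
  simp only [lintegral_prod _ (hm (g _) _)]
  rw [← lintegral_tsum fun i => (hm (g i) _).lintegral_prod_right']
  refine lintegral_mono_ae ?_
  filter_upwards [ae_kFunctional_le_tsum ι h] with w hw
  exact lintegral_kDensity_sub_le hι (f w) (fun i => g i w) hw c hc hS hr hcS

/-- The scalar inequality with `u = Ψ_g` leaves the integral of `(Ψ_g/V)^p`, at most one by the
reverse Hardy inequality. -/
theorem tsum_lintegral_Psi_sub_le [SFinite μ] (hι : IsOrderedPair ι) (hα : 0 < α) {θ V : ℝ}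
    (hθ : θ ∈ Ioo (0 : ℝ) 1) (hV : 0 < V) (g : Lp A₀ 1 μ)
    (hg : vectorLpNorm ι θ (pExp θ) (pExp θ) μ g ≤ ENNReal.ofReal V) :
    ∑' n, dyadicWeight α n * ∫⁻ z, ENNReal.ofReal
        (Psi ι g z - θ ^ (-α) * V * Real.exp (dyadicLevel n)) ∂(prodUnit μ) ≤
      ENNReal.ofReal (dyadicConst α * (α + 1) ^ α) * ENNReal.ofReal (θ ^ (-α) * V) := by
  have hp := one_lt_pExp hθ
  have hD := dyadicConst_pos hα
  have hθ0 := hθ.1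
  have hm : ∀ a : ℝ, AEMeasurable (fun z => ENNReal.ofReal (Psi ι g z - a)) (prodUnit μ) :=
    fun a => ((aemeasurable_Psi_Lp hι g).sub_const a).ennreal_ofReal
  have hint : ∫⁻ z, ENNReal.ofReal ((Psi ι g z / V) ^ pExp θ) ∂(prodUnit μ) ≤ 1 := by
    have h1 : ∫⁻ w, averagePow ι θ (g w) ∂μ ≤ ENNReal.ofReal (V ^ pExp θ) := by
      rw [vectorLpNorm_eq ι hθ, one_div, ENNReal.rpow_inv_le_iff (by positivity),
        ENNReal.ofReal_rpow_of_pos hV] at hg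
      exact hg
    have hVp : 0 < V ^ pExp θ := by positivity
    calc _ = ∫⁻ z, ENNReal.ofReal (Psi ι g z ^ pExp θ) * (ENNReal.ofReal (V ^ pExp θ))⁻¹
            ∂(prodUnit μ) := by
          refine lintegral_congr_ae ?_
          filter_upwards [ae_Psi_nonneg ι μ g] with z hz
          rw [Real.div_rpow hz hV.le, ENNReal.ofReal_div_of_pos hVp, div_eq_mul_inv]
      _ = (∫⁻ z, ENNReal.ofReal (Psi ι g z ^ pExp θ) ∂(prodUnit μ)) *
            (ENNReal.ofReal (V ^ pExp θ))⁻¹ := lintegral_mul_const' _ _ (by simpa using hVp)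
      _ ≤ ENNReal.ofReal (V ^ pExp θ) * (ENNReal.ofReal (V ^ pExp θ))⁻¹ := by
          gcongr
          exact (lintegral_Psi_rpow_le hι hθ g).trans h1
      _ ≤ 1 := ENNReal.mul_inv_le_one _
  calc _ = ∫⁻ z, ∑' n, dyadicWeight α n * ENNReal.ofReal
            (Psi ι g z - θ ^ (-α) * V * Real.exp (dyadicLevel n)) ∂(prodUnit μ) := by
        rw [lintegral_tsum fun n => (hm _).const_mul _]
        simp only [lintegral_const_mul'' _ (hm _)]
    _ ≤ ∫⁻ z, ENNReal.ofReal (dyadicConst α * (α + 1) ^ α * (θ ^ (-α) * V)) *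
          ENNReal.ofReal ((Psi ι g z / V) ^ pExp θ) ∂(prodUnit μ) := by
        refine lintegral_mono_ae ?_
        filter_upwards [ae_Psi_nonneg ι μ g] with z hz
        rw [← ENNReal.ofReal_mul (by positivity)]
        exact tsum_dyadicWeight_mul_sub_le hα hθ hz hV
    _ = ENNReal.ofReal (dyadicConst α * (α + 1) ^ α * (θ ^ (-α) * V)) *
          ∫⁻ z, ENNReal.ofReal ((Psi ι g z / V) ^ pExp θ) ∂(prodUnit μ) :=
        lintegral_const_mul' _ _ ENNReal.ofReal_ne_top
    _ ≤ _ := by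
        rw [← ENNReal.ofReal_mul (by positivity)]
        exact mul_le_of_le_one_right' hint

/-- The constant in the upper estimate of the Zygmund norm. -/
def upperConst (α m : ℝ) : ℝ := 1 + 2 * 4 ^ α * (m + dyadicConst α * (α + 1) ^ α)

theorem one_le_upperConst (hα : 0 < α) {m : ℝ} (hm : 0 ≤ m) : 1 ≤ upperConst α m := by
  have := dyadicConst_pos hα
  exact le_add_of_nonneg_right (by positivity)

theorem lLogLNorm_Psi_le_of_mem_sumRepresentations [IsFiniteMeasure μ] (hι : IsOrderedPair ι)
    (hα : 0 < α) {f : Lp A₀ 1 μ} {g : Ioo (0 : ℝ) 1 → Lp A₀ 1 μ}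
    (hg : g ∈ sumRepresentations ι μ f) {S : ℝ} (hS : 0 < S)
    (hgS : ∑' θ : Ioo (0 : ℝ) 1,
      ENNReal.ofReal ((θ : ℝ) ^ (-α)) * vectorLpNorm ι θ (pExp θ) (pExp θ) μ (g θ) ≤
        ENNReal.ofReal S) :
    lLogLNorm α (prodUnit μ) (Psi ι f) ≤
      ENNReal.ofReal (S * upperConst α (μ.real univ)) := by
  have hD := dyadicConst_pos hα
  have hθα : ∀ θ : Ioo (0 : ℝ) 1, 0 < (θ : ℝ) ^ (-α) := fun θ => Real.rpow_pos_of_pos θ.2.1 _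
  -- A finite sum has only countably many nonzero terms. Countability is needed for the
  -- almost-everywhere statement and for exchanging sum and integral.
  set T : Set (Ioo (0 : ℝ) 1) := Function.support fun θ : Ioo (0 : ℝ) 1 =>
    ENNReal.ofReal ((θ : ℝ) ^ (-α)) * vectorLpNorm ι θ (pExp θ) (pExp θ) μ (g θ) with hT
  have hTc : Countable T :=
    (Summable.countable_support_ennreal (ne_top_of_le_ne_top ENNReal.ofReal_ne_top hgS)).to_subtype
  have hsum : HasSum (fun θ : T => g θ) f := by
    refine (hasSum_subtype_iff_of_support_subset (Function.support_subset_iff'.2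
      fun θ hθ => ?_)).2 hg.2
    rw [hT, Function.notMem_support, mul_eq_zero, ENNReal.ofReal_eq_zero] at hθ
    exact eq_zero_of_vectorLpNorm_eq_zero hι θ.2 (hθ.resolve_left (not_le.2 (hθα θ)))
  set V : T → ℝ := fun θ => (vectorLpNorm ι θ (pExp θ) (pExp θ) μ (g θ)).toReal with hVdef
  have hVt : ∀ θ : T, ENNReal.ofReal (V θ) = vectorLpNorm ι θ (pExp θ) (pExp θ) μ (g θ) :=
    fun θ => ENNReal.ofReal_toReal (hg.1 θ).2.ne
  have hV0 : ∀ θ : T, 0 < V θ := fun θ =>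
    ENNReal.toReal_pos (right_ne_zero_of_mul θ.2) (hg.1 θ).2.ne
  have hcS : ∑' θ : T, ENNReal.ofReal (((θ : Ioo (0 : ℝ) 1) : ℝ) ^ (-α) * V θ) ≤
      ENNReal.ofReal S := by
    refine le_trans (le_of_eq ?_) hgS
    refine Eq.trans (tsum_congr fun θ => ?_) (tsum_subtype_support _)
    rw [ENNReal.ofReal_mul (hθα θ).le, hVt]
  -- The level `S e^{λ_n}` is shared out as `c_θ e^{λ_n}` with `c_θ = θ^{-α} V θ`, whose sum is at
  -- most `S`; each excess sum is at most a multiple of `c_θ`, and the total is again a multiple of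
  -- `S`.
  have key : ∑' n, dyadicWeight α n * ∫⁻ z, ENNReal.ofReal
      (Psi ι f z / S - Real.exp (dyadicLevel n)) ∂(prodUnit μ) ≤
        ENNReal.ofReal (dyadicConst α * (α + 1) ^ α) := by
    have hSS : ENNReal.ofReal S * (ENNReal.ofReal S)⁻¹ ≤ 1 := ENNReal.mul_inv_le_one _
    calc _ = ∑' n, dyadicWeight α n * ((∫⁻ z, ENNReal.ofReal
          (Psi ι f z - S * Real.exp (dyadicLevel n)) ∂(prodUnit μ)) * (ENNReal.ofReal S)⁻¹) := by
          refine tsum_congr fun n => ?_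
          rw [← lintegral_mul_const' _ _ (by simpa using hS)]
          congr 1
          refine lintegral_congr fun z => ?_
          rw [← div_eq_mul_inv, ← ENNReal.ofReal_div_of_pos hS, sub_div,
            mul_div_cancel_left₀ _ hS.ne']
      _ ≤ ∑' n, dyadicWeight α n * ((∑' θ : T, ∫⁻ z, ENNReal.ofReal
          (Psi ι (g θ) z - ((θ : Ioo (0 : ℝ) 1) : ℝ) ^ (-α) * V θ * Real.exp (dyadicLevel n))
            ∂(prodUnit μ)) * (ENNReal.ofReal S)⁻¹) := by
          gcongr with n
          exact lintegral_Psi_sub_le hι hsum _ (fun θ => (mul_pos (hθα θ) (hV0 θ)).le) hS.le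
            (Real.exp_pos _).le hcS
      _ = (∑' θ : T, ∑' n, dyadicWeight α n * ∫⁻ z, ENNReal.ofReal
          (Psi ι (g θ) z - ((θ : Ioo (0 : ℝ) 1) : ℝ) ^ (-α) * V θ * Real.exp (dyadicLevel n))
            ∂(prodUnit μ)) * (ENNReal.ofReal S)⁻¹ := by
          rw [ENNReal.tsum_comm]
          simp only [← mul_assoc, ENNReal.tsum_mul_right, ENNReal.tsum_mul_left]
      _ ≤ (∑' θ : T, ENNReal.ofReal (dyadicConst α * (α + 1) ^ α) *
          ENNReal.ofReal (((θ : Ioo (0 : ℝ) 1) : ℝ) ^ (-α) * V θ)) * (ENNReal.ofReal S)⁻¹ := by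
          gcongr with θ
          exact tsum_lintegral_Psi_sub_le hι hα (θ : Ioo (0 : ℝ) 1).2 (hV0 θ) _ (hVt θ).ge
      _ ≤ ENNReal.ofReal (dyadicConst α * (α + 1) ^ α) *
            (ENNReal.ofReal S * (ENNReal.ofReal S)⁻¹) := by
          rw [ENNReal.tsum_mul_left, mul_assoc]
          gcongr
      _ ≤ _ := mul_le_of_le_one_right' hSS
  have hm : ∀ a : ℝ, AEMeasurable (fun z => ENNReal.ofReal (Psi ι f z / S - a)) (prodUnit μ) :=
    fun a => (((aemeasurable_Psi_Lp hι f).div_const S).sub_const a).ennreal_ofReal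
  refine lLogLNorm_le_of_lintegral_le hα hS (one_le_upperConst hα measureReal_nonneg) ?_
  calc ∫⁻ z, ENNReal.ofReal (zygmund α (|Psi ι f z| / S)) ∂(prodUnit μ)
      ≤ ∫⁻ z, ENNReal.ofReal (2 * 4 ^ α) * (1 + ∑' n, dyadicWeight α n *
          ENNReal.ofReal (Psi ι f z / S - Real.exp (dyadicLevel n))) ∂(prodUnit μ) := by
        refine lintegral_mono_ae ?_
        filter_upwards [ae_Psi_nonneg ι μ f] with z hz
        rw [abs_of_nonneg hz]
        exact zygmund_le_tsum hα (by positivity)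
    _ = ENNReal.ofReal (2 * 4 ^ α) * (prodUnit μ univ + ∑' n, dyadicWeight α n *
          ∫⁻ z, ENNReal.ofReal (Psi ι f z / S - Real.exp (dyadicLevel n)) ∂(prodUnit μ)) := by
        rw [lintegral_const_mul' _ _ ENNReal.ofReal_ne_top, lintegral_add_left measurable_const,
          lintegral_one, lintegral_tsum fun n => (hm _).const_mul _]
        simp only [lintegral_const_mul'' _ (hm _)]
    _ ≤ ENNReal.ofReal (2 * 4 ^ α) *
          (ENNReal.ofReal (μ.real univ) + ENNReal.ofReal (dyadicConst α * (α + 1) ^ α)) := by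
        gcongr
        rw [ofReal_measureReal, ← univ_prod_univ, Measure.prod_prod, Measure.restrict_apply_univ,
          Real.volume_Ioo]
        simp
    _ ≤ _ := by
        rw [← ENNReal.ofReal_add measureReal_nonneg (by positivity),
          ← ENNReal.ofReal_mul (by positivity)]
        exact ENNReal.ofReal_le_ofReal (by rw [upperConst]; linarith)

theorem lLogLNorm_Psi_le_sumNorm [IsFiniteMeasure μ] (hι : IsOrderedPair ι) (hα : 0 < α)
    (f : Lp A₀ 1 μ) : lLogLNorm α (prodUnit μ) (Psi ι f) ≤
      ENNReal.ofReal (upperConst α (μ.real univ)) * sumNorm ι α μ f := by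
  have hC := one_le_upperConst (m := μ.real univ) hα measureReal_nonneg
  refine ENNReal_le_mul_of_forall_lt_ofReal (by simp; linarith) ENNReal.ofReal_ne_top
    fun S hS h => ?_
  rw [sumNorm] at h
  simp only [iInf_lt_iff] at h
  obtain ⟨g, hg, h⟩ := h
  rw [← ENNReal.ofReal_mul (by linarith), mul_comm]
  exact lLogLNorm_Psi_le_of_mem_sumRepresentations hι hα hg hS h.le

end UpperEstimate

/-! ### Measurable choice of nearly optimal decompositions, and their truncation. -/

section Selection

variable {𝕜 A₀ A₁ Ω : Type*} [RCLike 𝕜]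
  [NormedAddCommGroup A₀] [NormedSpace 𝕜 A₀] [NormedAddCommGroup A₁] [NormedSpace 𝕜 A₁]
  {ι : A₁ →L[𝕜] A₀} [MeasurableSpace Ω] {μ : Measure Ω}

/-- A function that factors through a measurable map into `ℕ`. -/
def CountablyValued {E : Type*} (a : Ω → E) : Prop :=
  ∃ (d : ℕ → E) (j : Ω → ℕ), Measurable j ∧ ∀ w, a w = d (j w)

namespace CountablyValued

variable {E : Type*}

theorem const (e : E) : CountablyValued fun _ : Ω => e :=
  ⟨fun _ => e, fun _ => 0, measurable_const, fun _ => rfl⟩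

theorem sub [Sub E] {a b : Ω → E} (ha : CountablyValued a) (hb : CountablyValued b) :
    CountablyValued fun w => a w - b w := by
  obtain ⟨d, j, hj, h⟩ := ha
  obtain ⟨d', j', hj', h'⟩ := hb
  refine ⟨fun k => d k.unpair.1 - d' k.unpair.2, fun w => Nat.pair (j w) (j' w), ?_, fun w => ?_⟩
  · exact (Measurable.of_discrete (f := fun p : ℕ × ℕ => Nat.pair p.1 p.2)).comp (hj.prodMk hj')
  · simp [h, h']

theorem ite {a : Ω → E} (ha : CountablyValued a) {s : Set Ω} (hs : MeasurableSet s) (e : E)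
    [DecidablePred (· ∈ s)] : CountablyValued fun w => if w ∈ s then a w else e := by
  obtain ⟨d, j, hj, h⟩ := ha
  refine ⟨fun k => Nat.casesOn k e d, fun w => if w ∈ s then j w + 1 else 0, ?_, fun w => ?_⟩
  · exact Measurable.ite hs (hj.add_const 1) measurable_const
  · by_cases hw : w ∈ s <;> simp [hw, h]

theorem stronglyMeasurable [TopologicalSpace E] {a : Ω → E} (ha : CountablyValued a) :
    StronglyMeasurable a := by
  obtain ⟨d, j, hj, h⟩ := ha
  rw [show a = d ∘ j from funext h]
  exact (StronglyMeasurable.of_discrete (f := d)).comp_measurable hj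

end CountablyValued

theorem averagePow_map_le (ι : A₁ →L[𝕜] A₀) {θ : ℝ} (hθ : θ ∈ Ioo (0 : ℝ) 1) (a : A₁) {X₀ X₁ : ℝ}
    (h₀ : ‖ι a‖ ≤ X₀) (h₁ : ‖a‖ ≤ X₁) :
    averagePow ι θ (ι a) ≤ ENNReal.ofReal (X₀ * X₁ ^ (pExp θ - 1)) := by
  refine averagePow_le hθ ((norm_nonneg _).trans h₀) ((norm_nonneg _).trans h₁)
    (fun s hs => (kFunctional_le_norm ι hs.le _).trans h₀) fun s hs => ?_
  calc kFunctional ι s (ι a) ≤ s * ‖a‖ := by simpa using kFunctional_le ι hs.le (ι a) a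
    _ ≤ s * X₁ := by gcongr

theorem interpNorm_map_lt_top (ι : A₁ →L[𝕜] A₀) {θ : ℝ} (hθ : θ ∈ Ioo (0 : ℝ) 1) (a : A₁) :
    interpNorm ι θ (pExp θ) (ι a) < ∞ := by
  have hp := one_lt_pExp hθ
  rw [interpNorm_eq ι hθ]
  exact ENNReal.rpow_lt_top_of_nonneg (by positivity) (ne_top_of_le_ne_top ENNReal.ofReal_ne_top
    (averagePow_map_le ι hθ a le_rfl le_rfl))

theorem StronglyMeasurableInto.congr {θ q : ℝ} {f g : Ω → A₀}
    (hf : StronglyMeasurableInto ι θ q μ f) (h : f =ᵐ[μ] g) :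
    StronglyMeasurableInto ι θ q μ g := by
  obtain ⟨F, hF, hlim⟩ := hf
  refine ⟨F, hF, ?_⟩
  filter_upwards [hlim, h] with w hw1 hw2
  rwa [← hw2]

/-- Keeping only the first `n` values gives simple functions that eventually equal the function at
every point, so convergence in the interpolation norm is trivial. -/
theorem CountablyValued.stronglyMeasurableInto {a : Ω → A₁} (ha : CountablyValued a)
    (ι : A₁ →L[𝕜] A₀) {θ : ℝ} (hθ : θ ∈ Ioo (0 : ℝ) 1) (μ : Measure Ω) :
    StronglyMeasurableInto ι θ (pExp θ) μ fun w => ι (a w) := by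
  obtain ⟨d, j, hj, h⟩ := ha
  refine ⟨fun n => ⟨fun w => if j w ≤ n then ι (d (j w)) else 0, fun y => ?_, ?_⟩, fun n w => ?_,
    .of_forall fun w => ?_⟩
  · exact hj (MeasurableSet.of_discrete (s := {k | (if k ≤ n then ι (d k) else 0) = y}))
  · refine (((finite_Iic n).image fun k => ι (d k)).union (finite_singleton 0)).subset ?_
    rintro _ ⟨w, rfl⟩
    by_cases hw : j w ≤ n
    · exact Or.inl ⟨j w, hw, by simp [hw]⟩
    · exact Or.inr (by simp [hw])
  · change interpNorm ι θ (pExp θ) (if j w ≤ n then ι (d (j w)) else 0) < ∞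
    split_ifs
    · exact interpNorm_map_lt_top ι hθ _
    · rw [interpNorm_zero ι hθ]; exact ENNReal.zero_lt_top
  · refine tendsto_const_nhds.congr' ?_
    filter_upwards [eventually_ge_atTop (j w)] with n hn
    change 0 = interpNorm ι θ (pExp θ) (ι (a w) - if j w ≤ n then ι (d (j w)) else 0)
    rw [if_pos hn, h, sub_self, interpNorm_zero ι hθ]

/-- A countably valued measurable choice of nearly optimal decompositions at the time `t`. -/
theorem exists_countablyValued_le_kFunctional (hι : IsOrderedPair ι) {f : Ω → A₀}
    (hf : StronglyMeasurable f) {t : ℝ} (ht : 0 < t) (ht1 : t ≤ 1) :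
    ∃ a : Ω → A₁, CountablyValued a ∧
      ∀ w, ‖f w - ι (a w)‖ + t * ‖a w‖ ≤ 2 * kFunctional ι t (f w) := by
  classical
  obtain ⟨c, hc, hfc⟩ := hf.isSeparable_range
  choose b hb using fun (y : A₀) (m : ℕ) =>
    exists_lt_kFunctional_add ι t y (ε := 1 / ((m : ℝ) + 1)) (by positivity)
  -- Near-optimal elements for a countable set whose closure contains the range of `f` are enough,
  -- since `K(t,·)` is 1-Lipschitz and the factor `2` leaves room. Zero is added for points where `f
  -- w = 0`, since there `K = 0` leaves no room.
  have hD : (insert 0 (⋃ y ∈ c, range (b y)) : Set A₁).Countable :=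
    (hc.biUnion fun y _ => countable_range _).insert 0
  obtain ⟨d, hd⟩ := hD.exists_eq_range (insert_nonempty _ _)
  have hex : ∀ w, ∃ n, ‖f w - ι (d n)‖ + t * ‖d n‖ ≤ 2 * kFunctional ι t (f w) := by
    intro w
    suffices h : ∃ a ∈ range d, ‖f w - ι a‖ + t * ‖a‖ ≤ 2 * kFunctional ι t (f w) by
      obtain ⟨_, ⟨n, rfl⟩, h⟩ := h
      exact ⟨n, h⟩
    rw [← hd]
    by_cases h0 : f w = 0
    · exact ⟨0, mem_insert _ _, by simp [h0, kFunctional_zero_right ι ht.le]⟩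
    have hK : 0 < kFunctional ι t (f w) :=
      (mul_pos ht (norm_pos_iff.2 h0)).trans_le (mul_norm_le_kFunctional hι ht.le ht1 _)
    obtain ⟨y, hy, hyd⟩ := Metric.mem_closure_iff.1 (hfc (mem_range_self w))
      (kFunctional ι t (f w) / 4) (by positivity)
    obtain ⟨m, hm⟩ := exists_nat_one_div_lt (show 0 < kFunctional ι t (f w) / 2 by positivity)
    refine ⟨b y m, Or.inr (mem_biUnion hy (mem_range_self m)), ?_⟩
    have h1 := hb y m
    have h2 := kFunctional_le_add_norm_sub ι ht.le y (f w)
    have h3 : ‖f w - ι (b y m)‖ ≤ ‖f w - y‖ + ‖y - ι (b y m)‖ := norm_sub_le_norm_sub_add_norm_sub ..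
    rw [dist_eq_norm] at hyd
    rw [norm_sub_rev] at h2
    linarith
  refine ⟨fun w => d (Nat.find (hex w)), ⟨d, fun w => Nat.find (hex w), ?_, fun _ => rfl⟩,
    fun w => Nat.find_spec (hex w)⟩
  refine measurable_find hex fun n => measurableSet_le ?_ ?_
  · exact ((hf.sub stronglyMeasurable_const).norm.measurable).add_const _
  · exact (((lipschitzWith_kFunctional ι ht.le).continuous.comp_stronglyMeasurable
      hf).measurable).const_mul 2

/-- The remainder `K(t_n, x)`, replaced by `‖x‖` where `‖x‖` exceeds the level `c exp (2^n - 1)`. -/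
def truncK (ι : A₁ →L[𝕜] A₀) (c : ℝ) (n : ℕ) (x : A₀) : ℝ :=
  if ‖x‖ ≤ c * Real.exp (dyadicLevel n) then kFunctional ι (Real.exp (-dyadicLevel n)) x else ‖x‖

theorem exp_neg_dyadicLevel_le_one (n : ℕ) : Real.exp (-dyadicLevel n) ≤ 1 :=
  Real.exp_le_one_iff.2 (neg_nonpos.2 (dyadicLevel_nonneg n))

theorem truncK_nonneg (ι : A₁ →L[𝕜] A₀) (c : ℝ) (n : ℕ) (x : A₀) : 0 ≤ truncK ι c n x := by
  unfold truncK
  split_ifs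
  · exact kFunctional_nonneg ι (Real.exp_pos _).le x
  · exact norm_nonneg x

theorem truncK_le_norm (ι : A₁ →L[𝕜] A₀) (c : ℝ) (n : ℕ) (x : A₀) : truncK ι c n x ≤ ‖x‖ := by
  unfold truncK
  split_ifs
  · exact kFunctional_le_norm ι (Real.exp_pos _).le x
  · exact le_rfl

theorem truncK_zero (hι : IsOrderedPair ι) (c : ℝ) (x : A₀) : truncK ι c 0 x = ‖x‖ := by
  unfold truncK
  split_ifs
  · rw [dyadicLevel_zero, neg_zero, Real.exp_zero, kFunctional_eq_norm hι le_rfl]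
  · rfl

theorem truncK_antitone (ι : A₁ →L[𝕜] A₀) {c : ℝ} (hc : 0 ≤ c) (x : A₀) :
    Antitone fun n => truncK ι c n x := by
  intro m n hmn
  have h := dyadicLevel_mono hmn
  by_cases hm : ‖x‖ ≤ c * Real.exp (dyadicLevel m)
  · have hn : ‖x‖ ≤ c * Real.exp (dyadicLevel n) := hm.trans (by gcongr)
    simp only [truncK, if_pos hm, if_pos hn]
    exact kFunctional_mono ι (Real.exp_pos _).le (by gcongr) x
  · simp only [truncK, if_neg hm]
    exact truncK_le_norm ι c n x

theorem stronglyMeasurable_truncK (ι : A₁ →L[𝕜] A₀) (c : ℝ) (n : ℕ) {f : Ω → A₀}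
    (hf : StronglyMeasurable f) : StronglyMeasurable fun w => truncK ι c n (f w) :=
  StronglyMeasurable.ite (measurableSet_le hf.norm.measurable measurable_const)
    ((lipschitzWith_kFunctional ι (Real.exp_pos _).le).continuous.comp_stronglyMeasurable hf) hf.norm

/-- Near optimality at time `e^{-λ_n}` only bounds `e^{-λ_n} ‖a‖` by `2‖f w‖`. Discarding points
with `‖f w‖ > c e^{λ_n}` makes this a bound uniform in `w`. The choice `a 0 = 0` lets the
telescoping start from zero. -/
theorem exists_truncated_approximation (hι : IsOrderedPair ι) {f : Ω → A₀}
    (hf : StronglyMeasurable f) {c : ℝ} (hc : 0 < c) :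
    ∃ a : ℕ → Ω → A₁, (∀ n, CountablyValued (a n)) ∧ (∀ w, a 0 w = 0) ∧
      ∀ n w, ‖f w - ι (a n w)‖ ≤ 2 * truncK ι c n (f w) ∧
        ‖a n w‖ ≤ 2 * c * Real.exp (2 * dyadicLevel n) := by
  classical
  choose b hbc hb using fun n => exists_countablyValued_le_kFunctional hι hf
    (Real.exp_pos (-dyadicLevel n)) (exp_neg_dyadicLevel_le_one n)
  have hs : ∀ n, MeasurableSet {w | ‖f w‖ ≤ c * Real.exp (dyadicLevel n)} := fun n =>
    measurableSet_le hf.norm.measurable measurable_const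
  refine ⟨fun n w => if n = 0 then 0 else
    if w ∈ {w | ‖f w‖ ≤ c * Real.exp (dyadicLevel n)} then b n w else 0, fun n => ?_,
    fun w => if_pos rfl, fun n w => ?_⟩
  · by_cases hn : n = 0
    · simpa only [if_pos hn] using CountablyValued.const 0
    · simpa only [if_neg hn] using (hbc n).ite (hs n) 0
  · have hN := norm_nonneg (f w)
    have hR := truncK_nonneg ι c n (f w)
    have hX : (0 : ℝ) ≤ 2 * c * Real.exp (2 * dyadicLevel n) := by positivity
    by_cases hn : n = 0
    · simp only [if_pos hn, map_zero, sub_zero, norm_zero]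
      refine ⟨?_, hX⟩
      rw [hn, truncK_zero hι]
      linarith
    simp only [if_neg hn, mem_ofPred_eq]
    by_cases hw : ‖f w‖ ≤ c * Real.exp (dyadicLevel n)
    · rw [if_pos hw, truncK, if_pos hw]
      have h1 := hb n w
      have ht := Real.exp_pos (-dyadicLevel n)
      refine ⟨by nlinarith [norm_nonneg (b n w)], ?_⟩
      have h2 := kFunctional_le_norm ι ht.le (f w)
      have h3 : Real.exp (-dyadicLevel n) * ‖b n w‖ ≤ 2 * (c * Real.exp (dyadicLevel n)) := by
        linarith [norm_nonneg (f w - ι (b n w))]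
      calc ‖b n w‖ = Real.exp (dyadicLevel n) * (Real.exp (-dyadicLevel n) * ‖b n w‖) := by
            rw [← mul_assoc, ← Real.exp_add, add_neg_cancel, Real.exp_zero, one_mul]
        _ ≤ Real.exp (dyadicLevel n) * (2 * (c * Real.exp (dyadicLevel n))) := by gcongr
        _ = _ := by rw [two_mul (dyadicLevel n), Real.exp_add]; ring
    · rw [if_neg hw, map_zero, sub_zero, norm_zero, truncK, if_neg hw]
      exact ⟨by linarith, hX⟩

end Selection

theorem lintegral_Ioo_inv_rpow :
    ∫⁻ s in Ioo (0 : ℝ) 1, ENNReal.ofReal (s⁻¹ ^ (3 / 4 : ℝ)) = 4 := by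
  have h1 : ∫⁻ s in Ioo (0 : ℝ) 1, ENNReal.ofReal (s⁻¹ ^ (3 / 4 : ℝ))
      = ∫⁻ s in Ioc (0 : ℝ) 1, ENNReal.ofReal (s ^ (-(3 / 4) : ℝ)) := by
    rw [← setLIntegral_congr Ioo_ae_eq_Ioc]
    refine setLIntegral_congr_fun measurableSet_Ioo fun s hs => ?_
    simp only [Real.inv_rpow hs.1.le, Real.rpow_neg hs.1.le]
  rw [h1, ← ofReal_integral_eq_lintegral_ofReal, ← intervalIntegral.integral_of_le zero_le_one,
    integral_rpow (Or.inl (by norm_num))]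
  · norm_num
  · exact (intervalIntegrable_iff_integrableOn_Ioc_of_le zero_le_one).1
      (intervalIntegral.intervalIntegrable_rpow' (by norm_num))
  · filter_upwards [ae_restrict_mem measurableSet_Ioc] with s hs
    exact Real.rpow_nonneg hs.1.le _

/-! ### Weighted sums of the truncated remainders against the Zygmund integral. -/

section Truncation

variable {𝕜 A₀ A₁ Ω : Type*} [RCLike 𝕜]
  [NormedAddCommGroup A₀] [NormedSpace 𝕜 A₀] [NormedAddCommGroup A₁] [NormedSpace 𝕜 A₁]
  {ι : A₁ →L[𝕜] A₀} [MeasurableSpace Ω] {μ : Measure Ω} {α : ℝ}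

theorem aemeasurable_kDensity (ι : A₁ →L[𝕜] A₀) (x : A₀) :
    AEMeasurable (fun s => kDensity ι s x) (volume.restrict (Ioo (0 : ℝ) 1)) :=
  aemeasurable_restrict_of_antitoneOn measurableSet_Ioo
    ((antitoneOn_kDensity ι x).mono Ioo_subset_Ioi_self)

theorem lintegral_kDensity_div (hι : IsOrderedPair ι) {c t : ℝ} (hc : 0 < c) (ht : 0 ≤ t) (x : A₀) :
    ∫⁻ s in Ioo 0 t, ENNReal.ofReal (kDensity ι s x / c)
      = ENNReal.ofReal (kFunctional ι t x / c) := by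
  simp only [ENNReal.ofReal_div_of_pos hc]
  simp only [div_eq_mul_inv]
  rw [lintegral_mul_const' _ _ (by simpa using hc), lintegral_kDensity hι ht]

/-- Both branches are integrals of `k`: `K(e^{-λ_n},x)` over `s < e^{-λ_n}`, that is `λ_n <
log(1/s)`, and `‖x‖` over all of `(0,1)`, occurring only if `λ_n < log(‖x‖/c)`. Only the level
conditions still depend on `n`. -/
theorem dyadicWeight_mul_truncK_le (hι : IsOrderedPair ι) {c : ℝ} (hc : 0 < c) (x : A₀) (n : ℕ) :
    dyadicWeight α n * ENNReal.ofReal (truncK ι c n x / c) ≤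
      ∫⁻ s in Ioo (0 : ℝ) 1, ENNReal.ofReal (kDensity ι s x / c) *
        ((if dyadicLevel n < Real.log s⁻¹ then dyadicWeight α n else 0) +
          if dyadicLevel n < Real.log (max 1 (‖x‖ / c)) then dyadicWeight α n else 0) := by
  have hw : dyadicWeight α n ≠ ∞ := ENNReal.ofReal_ne_top
  by_cases hn : ‖x‖ ≤ c * Real.exp (dyadicLevel n)
  · rw [truncK, if_pos hn, ← lintegral_kDensity_div hι hc (Real.exp_pos _).le,
      ← lintegral_const_mul' _ _ hw]
    refine le_trans ?_ (lintegral_mono_set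
      (Ioo_subset_Ioo_right (exp_neg_dyadicLevel_le_one n)))
    refine setLIntegral_mono' measurableSet_Ioo fun s hs => ?_
    have : dyadicLevel n < Real.log s⁻¹ := by
      rw [Real.log_inv, lt_neg, Real.log_lt_iff_lt_exp hs.1]
      exact hs.2
    rw [if_pos this, mul_comm]
    gcongr
    exact le_self_add
  · rw [truncK, if_neg hn, ← kFunctional_eq_norm hι le_rfl,
      ← lintegral_kDensity_div hι hc zero_le_one, ← lintegral_const_mul' _ _ hw]
    rw [kFunctional_eq_norm hι le_rfl]
    refine lintegral_mono fun s => ?_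
    have : dyadicLevel n < Real.log (max 1 (‖x‖ / c)) := by
      rw [Real.lt_log_iff_exp_lt (by positivity), lt_max_iff, lt_div_iff₀' hc]
      exact Or.inr (not_le.1 hn)
    rw [if_pos this, mul_comm]
    gcongr
    exact le_add_self

theorem tsum_dyadicWeight_mul_truncK_le (hι : IsOrderedPair ι) (hα : 0 < α) {c : ℝ} (hc : 0 < c)
    (x : A₀) : ∑' n, dyadicWeight α n * ENNReal.ofReal (truncK ι c n x / c) ≤
      ENNReal.ofReal (dyadicConst α * 4 ^ α) * ((2 + ENNReal.ofReal ((α + 1) ^ α)) *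
        (∫⁻ s in Ioo (0 : ℝ) 1, ENNReal.ofReal (zygmund α (kDensity ι s x / c))) +
          5 * ENNReal.ofReal ((α + 1) ^ α)) := by
  have hD := dyadicConst_pos hα
  have hk := aemeasurable_kDensity ι x
  set A : ℝ := (α + 1) ^ α with hA
  have hA0 : 0 ≤ A := by positivity
  set Y : ℝ := max 1 (‖x‖ / c) with hY
  have hY1 : 1 ≤ Y := le_max_left _ _
  have hlogY := Real.log_nonneg hY1
  set I := ∫⁻ s in Ioo (0 : ℝ) 1, ENNReal.ofReal (zygmund α (kDensity ι s x / c)) with hI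
  -- The truncation error closes up: `Y^{3/4} ≤ Y ≤ 1 + ‖x‖/c`, and `‖x‖/c = ∫₀¹ k/c` is at most
  -- `I`.
  have hYI : ENNReal.ofReal (Y ^ (3 / 4 : ℝ)) ≤ 1 + I := by
    calc ENNReal.ofReal (Y ^ (3 / 4 : ℝ)) ≤ ENNReal.ofReal (1 + ‖x‖ / c) := by
          refine ENNReal.ofReal_le_ofReal ?_
          calc Y ^ (3 / 4 : ℝ) ≤ Y ^ (1 : ℝ) :=
                Real.rpow_le_rpow_of_exponent_le hY1 (by norm_num)
            _ = Y := Real.rpow_one Y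
            _ ≤ 1 + ‖x‖ / c := max_le (by simp; positivity) (by simp)
      _ = 1 + ENNReal.ofReal (kFunctional ι 1 x / c) := by
          rw [ENNReal.ofReal_add zero_le_one (by positivity), ENNReal.ofReal_one,
            kFunctional_eq_norm hι le_rfl]
      _ ≤ 1 + I := by
          gcongr
          rw [← lintegral_kDensity_div hι hc zero_le_one, hI]
          refine setLIntegral_mono' measurableSet_Ioo fun s hs => ENNReal.ofReal_le_ofReal ?_
          exact self_le_zygmund hα (div_nonneg (kDensity_nonneg ι hs.1 x) hc.le)
  calc _ ≤ ∑' n, ∫⁻ s in Ioo (0 : ℝ) 1, ENNReal.ofReal (kDensity ι s x / c) *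
        ((if dyadicLevel n < Real.log s⁻¹ then dyadicWeight α n else 0) +
          if dyadicLevel n < Real.log Y then dyadicWeight α n else 0) :=
        ENNReal.tsum_le_tsum fun n => dyadicWeight_mul_truncK_le hι hc x n
    _ = ∫⁻ s in Ioo (0 : ℝ) 1, ENNReal.ofReal (kDensity ι s x / c) *
        ((∑' n, if dyadicLevel n < Real.log s⁻¹ then dyadicWeight α n else 0) +
          ∑' n, if dyadicLevel n < Real.log Y then dyadicWeight α n else 0) := by
        rw [← lintegral_tsum fun n => ?_]
        · simp only [ENNReal.tsum_mul_left, ENNReal.tsum_add]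
        · refine (hk.div_const c).ennreal_ofReal.mul (AEMeasurable.add_const ?_ _)
          exact (Measurable.ite (measurableSet_lt measurable_const
            (Real.measurable_log.comp measurable_inv)) measurable_const
              measurable_const).aemeasurable
    _ ≤ ∫⁻ s in Ioo (0 : ℝ) 1, ENNReal.ofReal (dyadicConst α * 4 ^ α) *
        (2 * ENNReal.ofReal (zygmund α (kDensity ι s x / c)) + ENNReal.ofReal A *
          (ENNReal.ofReal (s⁻¹ ^ (3 / 4 : ℝ)) + ENNReal.ofReal (Y ^ (3 / 4 : ℝ)))) := by
        refine setLIntegral_mono' measurableSet_Ioo fun s hs => ?_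
        have hu : 0 ≤ kDensity ι s x / c := div_nonneg (kDensity_nonneg ι hs.1 x) hc.le
        have hs1 : 1 ≤ s⁻¹ := (one_le_inv₀ hs.1).2 hs.2.le
        have hs0 : 0 < s⁻¹ := inv_pos.2 hs.1
        have hlogs := Real.log_nonneg hs1
        have hz := zygmund_nonneg (α := α) hu
        have h1 := mul_one_add_log_rpow_le hα hu hs1
        have h2 := mul_one_add_log_rpow_le hα hu hY1
        calc _ ≤ ENNReal.ofReal (kDensity ι s x / c) *
              (ENNReal.ofReal (dyadicConst α * (1 + Real.log s⁻¹) ^ α) +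
                ENNReal.ofReal (dyadicConst α * (1 + Real.log Y) ^ α)) := by
              gcongr
              · exact tsum_dyadicWeight_le hα hlogs
              · exact tsum_dyadicWeight_le hα hlogY
          _ = ENNReal.ofReal (kDensity ι s x / c * (dyadicConst α * (1 + Real.log s⁻¹) ^ α +
                dyadicConst α * (1 + Real.log Y) ^ α)) := by
              rw [← ENNReal.ofReal_add (by positivity) (by positivity), ← ENNReal.ofReal_mul hu]
          _ ≤ ENNReal.ofReal (dyadicConst α * 4 ^ α * (2 * zygmund α (kDensity ι s x / c) +
                A * (s⁻¹ ^ (3 / 4 : ℝ) + Y ^ (3 / 4 : ℝ)))) := by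
              refine ENNReal.ofReal_le_ofReal ?_
              rw [← hA] at h1 h2
              have h3 := mul_le_mul_of_nonneg_left (add_le_add h1 h2) hD.le
              refine le_trans (le_of_eq ?_) (h3.trans (le_of_eq ?_)) <;> ring
          _ = _ := by
              rw [ENNReal.ofReal_mul (by positivity), ENNReal.ofReal_add (by positivity)
                (by positivity), ENNReal.ofReal_mul zero_le_two, ENNReal.ofReal_mul hA0,
                ENNReal.ofReal_add (by positivity) (by positivity), ENNReal.ofReal_ofNat]
    _ = ENNReal.ofReal (dyadicConst α * 4 ^ α) *
          (2 * I + ENNReal.ofReal A * (4 + ENNReal.ofReal (Y ^ (3 / 4 : ℝ)))) := by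
        have hm : Measurable fun s : ℝ => ENNReal.ofReal A *
            (ENNReal.ofReal (s⁻¹ ^ (3 / 4 : ℝ)) + ENNReal.ofReal (Y ^ (3 / 4 : ℝ))) := by
          fun_prop
        rw [lintegral_const_mul' _ _ ENNReal.ofReal_ne_top, lintegral_add_right _ hm,
          lintegral_const_mul' _ _ (by norm_num), lintegral_const_mul' _ _ ENNReal.ofReal_ne_top,
          lintegral_add_right _ measurable_const, lintegral_Ioo_inv_rpow, setLIntegral_const,
          Real.volume_Ioo]
        simp [hI]
    _ ≤ ENNReal.ofReal (dyadicConst α * 4 ^ α) *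
          (2 * I + ENNReal.ofReal A * (4 + (1 + I))) := by gcongr
    _ = _ := by ring

/-- The constant in the estimate of the truncated remainders. -/
def truncConst (α m : ℝ) : ℝ :=
  dyadicConst α * 4 ^ α * (2 + (α + 1) ^ α + 5 * (α + 1) ^ α * m)

theorem truncConst_nonneg (hα : 0 < α) {m : ℝ} (hm : 0 ≤ m) : 0 ≤ truncConst α m := by
  have := dyadicConst_pos hα
  unfold truncConst
  positivity

theorem measurable_zygmund (α : ℝ) : Measurable (zygmund α) := by
  unfold zygmund
  fun_prop

theorem tsum_lintegral_truncK_le [IsFiniteMeasure μ] (hι : IsOrderedPair ι) (hα : 0 < α)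
    {c : ℝ} (hc : 0 < c) (f : Lp A₀ 1 μ)
    (h : ∫⁻ z, ENNReal.ofReal (zygmund α (|Psi ι f z| / c)) ∂(prodUnit μ) ≤ 1) :
    ∑' n, dyadicWeight α n * ∫⁻ w, ENNReal.ofReal (truncK ι c n (f w) / c) ∂μ ≤
      ENNReal.ofReal (truncConst α (μ.real univ)) := by
  have hD := dyadicConst_pos hα
  have hm : ∀ n, Measurable fun w => ENNReal.ofReal (truncK ι c n (f w) / c) := fun n =>
    ((stronglyMeasurable_truncK ι c n (Lp.stronglyMeasurable f)).measurable.div_const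
      c).ennreal_ofReal
  have h' : ∫⁻ w, (∫⁻ s in Ioo (0 : ℝ) 1,
      ENNReal.ofReal (zygmund α (kDensity ι s (f w) / c))) ∂μ ≤ 1 := by
    refine le_trans (le_of_eq ?_) h
    have e : ∫⁻ z, ENNReal.ofReal (zygmund α (|Psi ι f z| / c)) ∂(prodUnit μ)
        = ∫⁻ z, ENNReal.ofReal (zygmund α (Psi ι f z / c)) ∂(prodUnit μ) := by
      refine lintegral_congr_ae ?_
      filter_upwards [ae_Psi_nonneg ι μ f] with z hz
      rw [abs_of_nonneg hz]
    have hz : AEMeasurable (fun z => ENNReal.ofReal (zygmund α (Psi ι f z / c))) (prodUnit μ) :=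
      ((measurable_zygmund α).comp_aemeasurable
        ((aemeasurable_Psi_Lp hι f).div_const c)).ennreal_ofReal
    rw [e, lintegral_prod _ hz]
    rfl
  calc _ = ∫⁻ w, ∑' n, dyadicWeight α n * ENNReal.ofReal (truncK ι c n (f w) / c) ∂μ := by
        rw [lintegral_tsum fun n => ((hm n).const_mul _).aemeasurable]
        simp only [lintegral_const_mul _ (hm _)]
    _ ≤ ∫⁻ w, ENNReal.ofReal (dyadicConst α * 4 ^ α) * ((2 + ENNReal.ofReal ((α + 1) ^ α)) *
          (∫⁻ s in Ioo (0 : ℝ) 1, ENNReal.ofReal (zygmund α (kDensity ι s (f w) / c))) +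
            5 * ENNReal.ofReal ((α + 1) ^ α)) ∂μ :=
        lintegral_mono fun w => tsum_dyadicWeight_mul_truncK_le hι hα hc (f w)
    _ = ENNReal.ofReal (dyadicConst α * 4 ^ α) * ((2 + ENNReal.ofReal ((α + 1) ^ α)) *
          (∫⁻ w, (∫⁻ s in Ioo (0 : ℝ) 1,
            ENNReal.ofReal (zygmund α (kDensity ι s (f w) / c))) ∂μ) +
            5 * ENNReal.ofReal ((α + 1) ^ α) * μ univ) := by
        rw [lintegral_const_mul' _ _ ENNReal.ofReal_ne_top, lintegral_add_right _ measurable_const,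
          lintegral_const_mul' _ _ (by finiteness), lintegral_const]
    _ ≤ ENNReal.ofReal (dyadicConst α * 4 ^ α) * ((2 + ENNReal.ofReal ((α + 1) ^ α)) * 1 +
            5 * ENNReal.ofReal ((α + 1) ^ α) * μ univ) := by gcongr
    _ = _ := by
        rw [truncConst, ENNReal.ofReal_mul (p := dyadicConst α * 4 ^ α) (by positivity), ENNReal.ofReal_add (by positivity)
          (by positivity), ENNReal.ofReal_add (by positivity) (by positivity),
          ENNReal.ofReal_mul (by positivity), ENNReal.ofReal_mul (by positivity),
          ofReal_measureReal, mul_one]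
        simp

end Truncation

/-! ### The sum norm is bounded by the Zygmund norm. -/

section LowerEstimate

variable {𝕜 A₀ A₁ Ω : Type*} [RCLike 𝕜]
  [NormedAddCommGroup A₀] [NormedSpace 𝕜 A₀] [NormedAddCommGroup A₁] [NormedSpace 𝕜 A₁]
  {ι : A₁ →L[𝕜] A₀} [MeasurableSpace Ω] {μ : Measure Ω} {α : ℝ}

theorem dyadicTheta_le_half (n : ℕ) : dyadicTheta n ≤ 1 / 2 := by
  rw [dyadicTheta, one_div]
  refine inv_anti₀ two_pos ?_
  simpa using pow_le_pow_right₀ (one_le_two (α := ℝ)) (Nat.le_add_left 1 n)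

theorem pExp_dyadicTheta_sub_one_le (n : ℕ) : pExp (dyadicTheta n) - 1 ≤ 2 * dyadicTheta n := by
  have hθ := dyadicTheta_mem n
  have h2 := dyadicTheta_le_half n
  have hp : pExp (dyadicTheta n) ≤ 2 := by
    rw [pExp, div_le_iff₀ (by linarith)]; linarith
  rw [pExp_sub_one hθ]
  nlinarith [hθ.1]

/-- Here the choice of `θ_n` pays off: `p - 1 ≤ 2θ_n` and `2^(n+1) θ_n = 1`, so the exponent `2
λ_{n+1} (p - 1)` never exceeds `4`. -/
theorem level_rpow_le {c : ℝ} (hc : 0 < c) (n : ℕ) :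
    (4 * c * Real.exp (2 * dyadicLevel (n + 1))) ^ (pExp (dyadicTheta n) - 1) ≤
      4 * Real.exp 4 * c ^ (pExp (dyadicTheta n) - 1) := by
  have hθ := dyadicTheta_mem n
  have hp := one_lt_pExp hθ
  have h1 := pExp_dyadicTheta_sub_one_le n
  set q := pExp (dyadicTheta n) - 1 with hq
  have hq0 : 0 < q := by linarith
  have h2 := dyadicTheta_le_half n
  have h3 : dyadicLevel (n + 1) * q ≤ 2 := by
    have h4 : (2 : ℝ) ^ (n + 1) * dyadicTheta n = 1 := mul_inv_cancel₀ (by positivity)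
    have h5 : dyadicLevel (n + 1) ≤ 2 ^ (n + 1) := by unfold dyadicLevel; linarith
    calc dyadicLevel (n + 1) * q ≤ 2 ^ (n + 1) * (2 * dyadicTheta n) := by gcongr
      _ = 2 := by linarith
  rw [Real.mul_rpow (by positivity) (by positivity), Real.mul_rpow (by norm_num) hc.le,
    ← Real.exp_mul]
  have h6 : (4 : ℝ) ^ q ≤ 4 := by
    simpa using Real.rpow_le_rpow_of_exponent_le (show (1 : ℝ) ≤ 4 by norm_num)
      (show q ≤ 1 by linarith)
  have h7 : Real.exp (2 * dyadicLevel (n + 1) * q) ≤ Real.exp 4 :=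
    Real.exp_le_exp.2 (by linarith)
  calc _ ≤ 4 * c ^ q * Real.exp 4 := by gcongr
    _ = _ := by ring

/-- The difference has `A₀`-norm at most `4` times the larger remainder, the one at `n`, and
`A₁`-norm governed by the level `n + 1`. The `θ_n`-norm interpolates the two. -/
theorem averagePow_map_sub_le (ι : A₁ →L[𝕜] A₀) {c : ℝ} (hc : 0 < c) (n : ℕ) {x : A₀} {a b : A₁}
    (ha : ‖x - ι a‖ ≤ 2 * truncK ι c n x ∧ ‖a‖ ≤ 2 * c * Real.exp (2 * dyadicLevel n))
    (hb : ‖x - ι b‖ ≤ 2 * truncK ι c (n + 1) x ∧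
      ‖b‖ ≤ 2 * c * Real.exp (2 * dyadicLevel (n + 1))) :
    averagePow ι (dyadicTheta n) (ι (b - a)) ≤
      ENNReal.ofReal (16 * Real.exp 4 * c ^ pExp (dyadicTheta n)) *
        ENNReal.ofReal (truncK ι c n x / c) := by
  have hR := truncK_nonneg ι c n x
  have h0 : ‖ι (b - a)‖ ≤ 4 * truncK ι c n x := by
    have h := norm_sub_le (x - ι a) (x - ι b)
    rw [sub_sub_sub_cancel_left, ← map_sub] at h
    have := truncK_antitone ι hc.le x n.le_succ
    simp only at this
    linarith [ha.1, hb.1]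
  have h1 : ‖b - a‖ ≤ 4 * c * Real.exp (2 * dyadicLevel (n + 1)) := by
    have h := norm_sub_le b a
    have h2 : Real.exp (2 * dyadicLevel n) ≤ Real.exp (2 * dyadicLevel (n + 1)) := by
      have := dyadicLevel_mono n.le_succ
      gcongr
    have h3 := mul_le_mul_of_nonneg_left h2 hc.le
    linarith [ha.2, hb.2]
  refine (averagePow_map_le ι (dyadicTheta_mem n) _ h0 h1).trans ?_
  rw [← ENNReal.ofReal_mul (by positivity)]
  refine ENNReal.ofReal_le_ofReal ?_
  calc _ ≤ 4 * truncK ι c n x * (4 * Real.exp 4 * c ^ (pExp (dyadicTheta n) - 1)) := by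
        gcongr; exact level_rpow_le hc n
    _ = _ := by rw [Real.rpow_sub_one hc.ne']; ring

theorem vectorLpNorm_map_sub_le (ι : A₁ →L[𝕜] A₀) {c : ℝ} (hc : 0 < c) (n : ℕ) {f : Ω → A₀}
    {a b : Ω → A₁}
    (ha : ∀ w, ‖f w - ι (a w)‖ ≤ 2 * truncK ι c n (f w) ∧
      ‖a w‖ ≤ 2 * c * Real.exp (2 * dyadicLevel n))
    (hb : ∀ w, ‖f w - ι (b w)‖ ≤ 2 * truncK ι c (n + 1) (f w) ∧
      ‖b w‖ ≤ 2 * c * Real.exp (2 * dyadicLevel (n + 1))) :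
    vectorLpNorm ι (dyadicTheta n) (pExp (dyadicTheta n)) (pExp (dyadicTheta n)) μ
        (fun w => ι (b w - a w)) ≤
      ENNReal.ofReal (16 * Real.exp 4 * c) *
        (∫⁻ w, ENNReal.ofReal (truncK ι c n (f w) / c) ∂μ) ^ (1 - dyadicTheta n) := by
  have hθ := dyadicTheta_mem n
  have hp := one_lt_pExp hθ
  have h1 : 1 ≤ 16 * Real.exp 4 := by
    have := Real.one_le_exp (show (0 : ℝ) ≤ 4 by norm_num)
    linarith
  have hq : 0 ≤ 1 - dyadicTheta n := by linarith [hθ.2]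
  rw [vectorLpNorm_eq ι hθ, one_div_pExp]
  calc _ ≤ (ENNReal.ofReal (16 * Real.exp 4 * c ^ pExp (dyadicTheta n)) *
        ∫⁻ w, ENNReal.ofReal (truncK ι c n (f w) / c) ∂μ) ^ (1 - dyadicTheta n) := by
        refine ENNReal.rpow_le_rpow ?_ hq
        rw [← lintegral_const_mul' _ _ ENNReal.ofReal_ne_top]
        exact lintegral_mono fun w => averagePow_map_sub_le ι hc n (ha w) (hb w)
    _ = ENNReal.ofReal ((16 * Real.exp 4) ^ (1 - dyadicTheta n) * c) *
        (∫⁻ w, ENNReal.ofReal (truncK ι c n (f w) / c) ∂μ) ^ (1 - dyadicTheta n) := by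
        rw [ENNReal.mul_rpow_of_nonneg _ _ hq, ENNReal.ofReal_rpow_of_nonneg (by positivity) hq,
          Real.mul_rpow (by positivity) (by positivity), ← Real.rpow_mul hc.le,
          ← one_div_pExp, mul_one_div_cancel (by positivity), Real.rpow_one]
    _ ≤ _ := by
        gcongr
        simpa using Real.rpow_le_rpow_of_exponent_le h1
          (show 1 - dyadicTheta n ≤ 1 by linarith [hθ.1])

theorem vectorLpNorm_congr_ae {θ q p : ℝ} {f g : Ω → A₀} (h : f =ᵐ[μ] g) :
    vectorLpNorm ι θ q p μ f = vectorLpNorm ι θ q p μ g := by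
  have e : (fun w => interpNorm ι θ q (f w) ^ p) =ᵐ[μ] fun w => interpNorm ι θ q (g w) ^ p :=
    h.fun_comp fun x => interpNorm ι θ q x ^ p
  rw [vectorLpNorm, vectorLpNorm, lintegral_congr_ae e]

theorem MemVectorLp.congr {θ q p : ℝ} {f g : Ω → A₀} (hf : MemVectorLp ι θ q p μ f)
    (h : f =ᵐ[μ] g) : MemVectorLp ι θ q p μ g := by
  refine ⟨hf.1.congr h, ?_⟩
  rw [← vectorLpNorm_congr_ae h]
  exact hf.2

theorem vectorLpNorm_zero (ι : A₁ →L[𝕜] A₀) {θ : ℝ} (hθ : θ ∈ Ioo (0 : ℝ) 1) (μ : Measure Ω) :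
    vectorLpNorm ι θ (pExp θ) (pExp θ) μ (fun _ => (0 : A₀)) = 0 := by
  have hp := one_lt_pExp hθ
  simp only [vectorLpNorm, interpNorm_zero ι hθ]
  rw [ENNReal.zero_rpow_of_pos (by positivity), lintegral_zero,
    ENNReal.zero_rpow_of_pos (by positivity)]

theorem memVectorLp_zero (ι : A₁ →L[𝕜] A₀) {θ : ℝ} (hθ : θ ∈ Ioo (0 : ℝ) 1) (μ : Measure Ω) :
    MemVectorLp ι θ (pExp θ) (pExp θ) μ (fun _ => (0 : A₀)) := by
  refine ⟨?_, by rw [vectorLpNorm_zero ι hθ]; exact ENNReal.zero_lt_top⟩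
  simpa using (CountablyValued.const (0 : A₁)).stronglyMeasurableInto ι hθ μ

/-- A sequence placed at distinct parameters is extended by zero to a family over all of `(0,1)`. -/
theorem sumNorm_le_tsum (ι : A₁ →L[𝕜] A₀) (α : ℝ) {f : Lp A₀ 1 μ} {D : ℕ → Lp A₀ 1 μ}
    {θ : ℕ → Ioo (0 : ℝ) 1} (hθ : Function.Injective θ) (hD : HasSum D f)
    (hmem : ∀ n, MemVectorLp ι (θ n) (pExp (θ n)) (pExp (θ n)) μ (D n)) :
    sumNorm ι α μ f ≤ ∑' n, ENNReal.ofReal ((θ n : ℝ) ^ (-α)) *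
      vectorLpNorm ι (θ n) (pExp (θ n)) (pExp (θ n)) μ (D n) := by
  have h0 : ∀ t, t ∉ range θ → Function.extend θ D 0 t = 0 := fun t ht => by
    rw [Function.extend_apply' _ _ _ ht, Pi.zero_apply]
  have hz : ((0 : Lp A₀ 1 μ) : Ω → A₀) =ᵐ[μ] fun _ => 0 := Lp.coeFn_zero A₀ 1 μ
  have hrep : Function.extend θ D 0 ∈ sumRepresentations ι μ f := by
    refine ⟨fun t => ?_, (hasSum_extend_zero hθ).2 hD⟩
    by_cases ht : t ∈ range θ
    · obtain ⟨n, rfl⟩ := ht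
      rw [hθ.extend_apply]
      exact hmem n
    · rw [h0 t ht]
      exact (memVectorLp_zero ι t.2 μ).congr hz.symm
  refine (iInf₂_le _ hrep).trans ?_
  rw [← hθ.tsum_eq]
  · simp only [hθ.extend_apply]
    exact le_rfl
  · intro t ht
    by_contra hn
    refine ht ?_
    simp only [h0 t hn]
    rw [vectorLpNorm_congr_ae hz, vectorLpNorm_zero ι t.2, mul_zero]

/-- The constant in the estimate of the norm of the extrapolation space. -/
def lowerConst (α m : ℝ) : ℝ :=
  2 ^ α * (16 * Real.exp 4) * (2 ^ (α + 1) * (truncConst α m + 2))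

theorem lowerConst_nonneg (hα : 0 < α) {m : ℝ} (hm : 0 ≤ m) : 0 ≤ lowerConst α m := by
  have := truncConst_nonneg hα hm
  unfold lowerConst
  positivity

theorem one_le_dyadicWeight (hα : 0 < α) (n : ℕ) : 1 ≤ dyadicWeight α n :=
  ENNReal.one_le_ofReal.2 (Real.one_le_rpow (one_le_pow₀ one_le_two) hα.le)

theorem hasSum_sub_of_tsum_enorm {E : Type*} [NormedAddCommGroup E] [CompleteSpace E] {B : ℕ → E}
    {f : E} (h0 : B 0 = 0) (h : ∑' n, ‖f - B n‖ₑ ≠ ∞) : HasSum (fun n => B (n + 1) - B n) f := by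
  have hs : Summable fun n => ‖f - B n‖ := by simpa using ENNReal.summable_toReal h
  have hD : Summable fun n => B (n + 1) - B n := by
    refine Summable.of_norm_bounded (((summable_nat_add_iff 1).2 hs).add hs) fun n => ?_
    have := norm_sub_le (f - B n) (f - B (n + 1))
    rw [sub_sub_sub_cancel_left] at this
    linarith
  rw [hD.hasSum_iff_tendsto_nat, tendsto_iff_norm_sub_tendsto_zero]
  simp only [Finset.sum_range_sub, h0, sub_zero]
  simpa only [norm_sub_rev f] using hs.tendsto_atTop_zero

theorem sumNorm_le_of_lintegral_le [CompleteSpace A₀] [IsFiniteMeasure μ] (hι : IsOrderedPair ι)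
    (hα : 0 < α) {c : ℝ} (hc : 0 < c) (f : Lp A₀ 1 μ)
    (h : ∫⁻ z, ENNReal.ofReal (zygmund α (|Psi ι f z| / c)) ∂(prodUnit μ) ≤ 1) :
    sumNorm ι α μ f ≤ ENNReal.ofReal (lowerConst α (μ.real univ)) * ENNReal.ofReal c := by
  have hM := truncConst_nonneg (m := μ.real univ) hα measureReal_nonneg
  have he := tsum_lintegral_truncK_le hι hα hc f h
  obtain ⟨a, hac, ha0, hb⟩ := exists_truncated_approximation hι (Lp.stronglyMeasurable f) hc
  set e : ℕ → ℝ≥0∞ := fun n => ∫⁻ w, ENNReal.ofReal (truncK ι c n (f w) / c) ∂μ with he_def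
  have hsm : ∀ n, StronglyMeasurable fun w => ι (a n w) := fun n =>
    ι.continuous.comp_stronglyMeasurable (hac n).stronglyMeasurable
  have hB : ∀ n, MemLp (fun w => ι (a n w)) 1 μ := fun n => by
    refine (Lp.memLp f).of_le_mul (c := 3) (hsm n).aestronglyMeasurable (.of_forall fun w => ?_)
    have h1 := (hb n w).1
    have h2 := truncK_le_norm ι c n (f w)
    have h3 := norm_sub_norm_le (ι (a n w)) (f w)
    rw [norm_sub_rev] at h3
    linarith
  set B : ℕ → Lp A₀ 1 μ := fun n => (hB n).toLp with hB_def
  have hB0 : B 0 = 0 := by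
    rw [hB_def, Lp.eq_zero_iff_ae_eq_zero]
    filter_upwards [(hB 0).coeFn_toLp] with w hw
    rw [hw, ha0, map_zero, Pi.zero_apply]
  have hfB : ∀ n, ‖f - B n‖ₑ ≤ ENNReal.ofReal (2 * c) * e n := fun n => by
    rw [Lp.enorm_def, eLpNorm_one_eq_lintegral_enorm, he_def,
      ← lintegral_const_mul' _ _ ENNReal.ofReal_ne_top]
    refine lintegral_mono_ae ?_
    filter_upwards [Lp.coeFn_sub f (B n), (hB n).coeFn_toLp] with w h1 h2
    rw [h1, Pi.sub_apply, h2, ← ofReal_norm, ← ENNReal.ofReal_mul (by positivity)]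
    refine ENNReal.ofReal_le_ofReal ((hb n w).1.trans (le_of_eq ?_))
    field_simp
  have hsum : HasSum (fun n => B (n + 1) - B n) f := by
    -- The dyadic weights are at least one, so the weighted bound on the remainders already gives
    -- absolute convergence of the telescoping series in `L¹`, where completeness of `A₀` is used.
    refine hasSum_sub_of_tsum_enorm hB0 (ne_top_of_le_ne_top ?_ (ENNReal.tsum_le_tsum hfB))
    rw [ENNReal.tsum_mul_left]
    refine ENNReal.mul_ne_top ENNReal.ofReal_ne_top
      (ne_top_of_le_ne_top ENNReal.ofReal_ne_top (le_trans (ENNReal.tsum_le_tsum fun n => ?_) he))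
    exact le_mul_of_one_le_left' (one_le_dyadicWeight hα n)
  have hae : ∀ n, (fun w => ι (a (n + 1) w - a n w)) =ᵐ[μ] (B (n + 1) - B n : Lp A₀ 1 μ) :=
    fun n => by
      filter_upwards [Lp.coeFn_sub (B (n + 1)) (B n), (hB (n + 1)).coeFn_toLp, (hB n).coeFn_toLp]
        with w h1 h2 h3
      rw [h1, Pi.sub_apply, h2, h3, map_sub]
  have hV : ∀ n, vectorLpNorm ι (dyadicTheta n) (pExp (dyadicTheta n)) (pExp (dyadicTheta n)) μ
      (fun w => ι (a (n + 1) w - a n w)) ≤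
        ENNReal.ofReal (16 * Real.exp 4 * c) * e n ^ (1 - dyadicTheta n) := fun n =>
    vectorLpNorm_map_sub_le ι hc n (hb n) (hb (n + 1))
  have he_top : ∀ n, e n < ∞ := fun n =>
    (le_mul_of_one_le_left' (one_le_dyadicWeight hα n)).trans_lt
      (((ENNReal.le_tsum n).trans he).trans_lt ENNReal.ofReal_lt_top)
  have hmem : ∀ n, MemVectorLp ι (dyadicTheta n) (pExp (dyadicTheta n)) (pExp (dyadicTheta n)) μ
      (B (n + 1) - B n : Lp A₀ 1 μ) := fun n => by
    refine MemVectorLp.congr ⟨((hac (n + 1)).sub (hac n)).stronglyMeasurableInto ι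
      (dyadicTheta_mem n) μ, (hV n).trans_lt (ENNReal.mul_lt_top ENNReal.ofReal_lt_top ?_)⟩ (hae n)
    exact ENNReal.rpow_lt_top_of_nonneg (by linarith [(dyadicTheta_mem n).2]) (he_top n).ne
  have hinj : Function.Injective fun n => (⟨dyadicTheta n, dyadicTheta_mem n⟩ : Ioo (0 : ℝ) 1) :=
    fun m n hmn => dyadicTheta_injective (Subtype.ext_iff.1 hmn)
  refine (sumNorm_le_tsum ι α hinj hsum hmem).trans ?_
  calc _ ≤ ∑' n, ENNReal.ofReal (2 ^ α) * ENNReal.ofReal (16 * Real.exp 4 * c) *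
        (dyadicWeight α n * e n ^ (1 - dyadicTheta n)) := by
        refine ENNReal.tsum_le_tsum fun n => ?_
        simp only
        rw [← vectorLpNorm_congr_ae (hae n), dyadicTheta_rpow]
        refine (mul_le_mul_right (hV n) _).trans (le_of_eq ?_)
        ring
    _ ≤ ENNReal.ofReal (2 ^ α) * ENNReal.ofReal (16 * Real.exp 4 * c) *
        (ENNReal.ofReal (2 ^ (α + 1)) * (∑' n, dyadicWeight α n * e n + 2)) := by
        rw [ENNReal.tsum_mul_left]
        gcongr
        exact tsum_dyadicWeight_mul_rpow_le hα e
    _ ≤ ENNReal.ofReal (2 ^ α) * ENNReal.ofReal (16 * Real.exp 4 * c) *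
        (ENNReal.ofReal (2 ^ (α + 1)) * (ENNReal.ofReal (truncConst α (μ.real univ)) + 2)) := by
        gcongr
    _ = _ := by
        rw [← ENNReal.ofReal_mul (lowerConst_nonneg hα measureReal_nonneg),
          show (2 : ℝ≥0∞) = ENNReal.ofReal 2 by simp, ← ENNReal.ofReal_add hM zero_le_two,
          ← ENNReal.ofReal_mul (by positivity), ← ENNReal.ofReal_mul (by positivity),
          ← ENNReal.ofReal_mul (by positivity)]
        congr 1
        rw [lowerConst]
        ring

end LowerEstimate

/-! ### Passage from a single admissible `c` to the Luxemburg norm. -/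

section Equivalence

variable {𝕜 A₀ A₁ Ω : Type*} [RCLike 𝕜]
  [NormedAddCommGroup A₀] [NormedSpace 𝕜 A₀] [NormedAddCommGroup A₁] [NormedSpace 𝕜 A₁]
  {ι : A₁ →L[𝕜] A₀} [MeasurableSpace Ω] {μ : Measure Ω} {α : ℝ}

theorem sumNorm_le_lLogLNorm_Psi [CompleteSpace A₀] [IsFiniteMeasure μ] (hι : IsOrderedPair ι)
    (hα : 0 < α) {C : ℝ≥0∞} (hC : ENNReal.ofReal (lowerConst α (μ.real univ)) ≤ C)
    (hC0 : C ≠ 0) (hC' : C ≠ ∞) (f : Lp A₀ 1 μ) :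
    sumNorm ι α μ f ≤ C * lLogLNorm α (prodUnit μ) (Psi ι f) := by
  refine ENNReal_le_mul_of_forall_lt_ofReal hC0 hC' fun S _ h => ?_
  rw [lLogLNorm] at h
  simp only [iInf_lt_iff] at h
  obtain ⟨c, ⟨hc, hint⟩, hcS⟩ := h
  exact (sumNorm_le_of_lintegral_le hι hα hc f hint).trans (mul_le_mul' hC hcS.le)

end Equivalence

/-! ### Finite Luxemburg norm against membership in the Zygmund class. -/

section Zygmund

variable {Θ : Type*} [MeasurableSpace Θ] {ν : Measure Θ} {g : Θ → ℝ} {α : ℝ}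

theorem lLogLNorm_lt_top_iff_memLLogL [IsFiniteMeasure ν] (hα : 0 < α)
    (hg : AEStronglyMeasurable g ν) : lLogLNorm α ν g < ∞ ↔ MemLLogL α ν g := by
  constructor
  · intro h
    refine ⟨hg, ?_⟩
    rw [lLogLNorm] at h
    simp only [iInf_lt_iff] at h
    obtain ⟨c, ⟨hc, hint⟩, -⟩ := h
    -- The logarithmic estimate needs a scale at least one; monotonicity of the Young function
    -- permits enlarging `c`.
    set C := max 1 c with hC
    have hC1 : 1 ≤ C := le_max_left _ _
    have hl := Real.log_nonneg hC1
    calc _ ≤ ∫⁻ z, ENNReal.ofReal (C * (1 + Real.log C) ^ α) *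
          ENNReal.ofReal (zygmund α (|g z| / c)) ∂ν := by
          refine lintegral_mono fun z => ?_
          rw [← ENNReal.ofReal_mul (by positivity)]
          refine ENNReal.ofReal_le_ofReal ((mul_posLog_rpow_le hα (abs_nonneg _) hC1).trans ?_)
          gcongr
          exact zygmund_mono hα (by positivity)
            (div_le_div_of_nonneg_left (abs_nonneg _) hc (le_max_right _ _))
      _ = ENNReal.ofReal (C * (1 + Real.log C) ^ α) *
          ∫⁻ z, ENNReal.ofReal (zygmund α (|g z| / c)) ∂ν :=
          lintegral_const_mul' _ _ ENNReal.ofReal_ne_top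
      _ ≤ ENNReal.ofReal (C * (1 + Real.log C) ^ α) * 1 := by gcongr; exact hint
      _ < ∞ := by finiteness
  · rintro ⟨-, h⟩
    have hX : ∫⁻ z, ENNReal.ofReal (zygmund α (|g z| / 1)) ∂ν < ∞ := by
      calc _ ≤ ∫⁻ z, ENNReal.ofReal (3 * 2 ^ α) *
            (1 + ENNReal.ofReal (|g z| * Real.posLog |g z| ^ α)) ∂ν := by
            refine lintegral_mono fun z => ?_
            have h0 : 0 ≤ |g z| * Real.posLog |g z| ^ α :=
              mul_nonneg (abs_nonneg _) (Real.rpow_nonneg Real.posLog_nonneg _)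
            rw [← ENNReal.ofReal_one, ← ENNReal.ofReal_add zero_le_one h0,
              ← ENNReal.ofReal_mul (by positivity), div_one]
            exact ENNReal.ofReal_le_ofReal (zygmund_le_posLog hα (abs_nonneg _))
        _ = ENNReal.ofReal (3 * 2 ^ α) * (ν univ +
            ∫⁻ z, ENNReal.ofReal (|g z| * Real.posLog |g z| ^ α) ∂ν) := by
            rw [lintegral_const_mul' _ _ ENNReal.ofReal_ne_top, lintegral_add_left measurable_const,
              lintegral_one]
        _ < ∞ := by finiteness
    refine (lLogLNorm_le_of_lintegral_le hα one_pos (le_max_left 1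
      (∫⁻ z, ENNReal.ofReal (zygmund α (|g z| / 1)) ∂ν).toReal) ?_).trans_lt ENNReal.ofReal_lt_top
    exact (ENNReal.ofReal_toReal hX.ne).ge.trans (ENNReal.ofReal_le_ofReal (le_max_right _ _))

end Zygmund

/-- The two-sided bound with a finite constant makes both norms finite for the same `f`, which
yields the equality of sets. -/
theorem sumSpace_eq_and_norms_equivalent {𝕜 A₀ A₁ Ω : Type*} [RCLike 𝕜]
    [NormedAddCommGroup A₀] [NormedSpace 𝕜 A₀] [CompleteSpace A₀]
    [NormedAddCommGroup A₁] [NormedSpace 𝕜 A₁]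
    (ι : A₁ →L[𝕜] A₀) (hι : IsOrderedPair ι)
    [MeasurableSpace Ω] (μ : Measure Ω) [IsFiniteMeasure μ] (α : ℝ) (hα : 0 < α) :
    sumSpace ι α μ =
        {f : Lp A₀ 1 μ | MemLLogL α (μ.prod (volume.restrict (Ioo (0 : ℝ) 1)))
          (Psi ι f)} ∧
      ∃ C : ℝ≥0, ∀ f : Lp A₀ 1 μ,
        sumNorm ι α μ f ≤
            C * lLogLNorm α (μ.prod (volume.restrict (Ioo (0 : ℝ) 1)))
              (Psi ι f) ∧
          lLogLNorm α (μ.prod (volume.restrict (Ioo (0 : ℝ) 1)))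
              (Psi ι f) ≤
            C * sumNorm ι α μ f := by
  have hU : 1 ≤ upperConst α (μ.real univ) := one_le_upperConst hα measureReal_nonneg
  have hL : 0 ≤ lowerConst α (μ.real univ) := lowerConst_nonneg hα measureReal_nonneg
  obtain ⟨C, hC, h₁, h₂⟩ : ∃ C : ℝ≥0, C ≠ 0 ∧
      ENNReal.ofReal (lowerConst α (μ.real univ)) ≤ C ∧
      ENNReal.ofReal (upperConst α (μ.real univ)) ≤ C := by
    refine ⟨(lowerConst α (μ.real univ) + upperConst α (μ.real univ)).toNNReal, ?_,
      ENNReal.ofReal_le_ofReal (by linarith), ENNReal.ofReal_le_ofReal (by linarith)⟩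
    rw [ne_eq, Real.toNNReal_eq_zero, not_le]
    linarith
  have hle : ∀ f : Lp A₀ 1 μ, sumNorm ι α μ f ≤ C * lLogLNorm α (prodUnit μ) (Psi ι f) :=
    sumNorm_le_lLogLNorm_Psi hι hα h₁ (by simpa using hC) ENNReal.coe_ne_top
  have hge : ∀ f : Lp A₀ 1 μ, lLogLNorm α (prodUnit μ) (Psi ι f) ≤ C * sumNorm ι α μ f :=
    fun f => (lLogLNorm_Psi_le_sumNorm hι hα f).trans (mul_le_mul' h₂ le_rfl)
  refine ⟨?_, C, fun f => ⟨hle f, hge f⟩⟩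
  ext f
  refine Iff.trans ?_ (lLogLNorm_lt_top_iff_memLLogL hα (aestronglyMeasurable_Psi_Lp hι f))
  exact ⟨fun h => (hge f).trans_lt (ENNReal.mul_lt_top ENNReal.coe_lt_top h),
    fun h => (hle f).trans_lt (ENNReal.mul_lt_top ENNReal.coe_lt_top h)⟩

end VectorYano

end

theorem mainTheorem11 {𝕜 A₀ A₁ Ω : Type*} [RCLike 𝕜]
    [NormedAddCommGroup A₀] [NormedSpace 𝕜 A₀] [CompleteSpace A₀]
    [NormedAddCommGroup A₁] [NormedSpace 𝕜 A₁] [CompleteSpace A₁]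
    (ι : A₁ →L[𝕜] A₀) (hι : VectorYano.IsOrderedPair ι)
    [MeasurableSpace Ω] (μ : Measure Ω) [IsFiniteMeasure μ] (α : ℝ) (hα : 0 < α) :
    VectorYano.sumSpace ι α μ =
        {f : Lp A₀ 1 μ | VectorYano.MemLLogL α (μ.prod (volume.restrict (Ioo (0 : ℝ) 1)))
          (VectorYano.Psi ι f)} ∧
      ∃ C : ℝ≥0, ∀ f : Lp A₀ 1 μ,
        VectorYano.sumNorm ι α μ f ≤
            C * VectorYano.lLogLNorm α (μ.prod (volume.restrict (Ioo (0 : ℝ) 1)))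
              (VectorYano.Psi ι f) ∧
          VectorYano.lLogLNorm α (μ.prod (volume.restrict (Ioo (0 : ℝ) 1)))
              (VectorYano.Psi ι f) ≤
            C * VectorYano.sumNorm ι α μ f :=
  VectorYano.sumSpace_eq_and_norms_equivalent ι hι μ α hα
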